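/- **Setting.** Let $\mathrm{Mp}_1(\mathbb R)$ be the group of pairs $(g,\omega)$ with $g=\begin{pmatrix}a&b\\c&d\end{pmatrix}\in \mathrm{SL}_2(\mathbb R)$ and $\omega:\mathbb H\to\mathbb C$ holomorphic with $\omega(\tau)^2=c\tau+d$, with product $(g,\omega)(g',\omega')=(gg',\ \tau\mapsto\omega(g'\tau)\omega'(\tau))$. Let $K$ and $\mathrm{Mp}_1(\mathbb Z)$ be the preimages of $\mathrm{SO}_2(\mathbb R)$ and $\mathrm{SL}_2(\mathbb Z)$, let $k(\theta)\in K$ be the element over $\begin{pmatrix}\cos\theta&\sin\theta\\-\sin\theta&\cos\theta\end{pmatrix}$ with $\omega(i)=e^{-i\theta/2}$, and let $\mathfrak g_{\mathbb C}=\mathfrak{sl}_2(\mathbb C)$ be the complexified Lie algebra, acting on functions on $\mathrm{Mp}_1(\mathbb R)$ by $((X+iY)\varphi)(h)=\partial_{t=0}\varphi(h\exp(tX))+i\,\partial_{t=0}\varphi(h\exp(tY))$ for real $X,Y$; $K$ acts by right translation. Isomorphisms, exact sequences and splittings below are those of $(\mathfrak g,K)$-modules. Let $\Gamma\subseteq\mathrm{Mp}_1(\mathbb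 Z)$ be a subgroup of finite index, $\rho$ a representation of $\Gamma$ on a finite-dimensional complex vector space $V$, and $k\in\frac12+\mathbb Z$. For $f:\mathbb H\to V$ put $(f|_k(g,\omega))(\tau)=\omega(\tau)^{-2k}f(g\tau)$. With $\tau=u+iv$ let $R_k=2i\partial_\tau+kv^{-1}$, $L_k=-2iv^2\partial_{\bar\tau}$ and $\Delta_k=-R_{k-2}L_k$. A *harmonic weak Maaß form* of weight $k$ and type $\rho$ is a smooth $f:\mathbb H\to V$ with $\Delta_kf=0$, with $\rho(\gamma)^{-1}(f|_k\gamma)=f$ for all $\gamma\in\Gamma$, and such that for some $a\in\mathbb R$ and every $\gamma\in\mathrm{Mp}_1(\mathbb Z)$ one has $(f|_k\gamma)(\tau)=O(e^{av})$ as $v\to\infty$, uniformly in $u$. It is a *weakly holomorphic modular form* if it is moreover holomorphic on $\mathbb H$. Let $A(\mathrm{Mp}_1(\mathbb R),\rho)$ be the space of functions $\varphi:\mathrm{Mp}_1(\mathbb R)\to V$ with $\varphi(\gamma h)=\rho(\gamma)\varphi(h)$ for $\gamma\in\Gamma$ that are linear combinations of smooth functions $\psi$ with $\psi(h\,k(\theta))=e^{ij\theta}\psi(h)$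 for some $j\in\frac12\mathbb Z$. Let $\tilde f((g,\omega))=\omega(i)^{-2k}f(gi)$, and let $\varpi(f,k)$ be the $(\mathfrak g,K)$-module generated by $\tilde f$. For $\nu\in\mathbb C$ and $j\in\frac12\mathbb Z$ let $\phi_{j}=\phi_{\nu,j}$ be the function on $\mathrm{Mp}_1(\mathbb R)$ given by $$\phi_{\nu,j}((g,\omega))=\operatorname{Im}(gi)^{(\nu+1)/2}\,\bigl(\omega(i)/|\omega(i)|\bigr)^{-2j};$$ it satisfies $\phi_{\nu,j}(k(\theta))=e^{ij\theta}$ and belongs to a principal series with parameter $\nu$. For $\nu\in\frac12\mathbb Z$, let $\varpi^+(\nu)$ and $\varpi^-(\nu)$ be the $(\mathfrak g,K)$-modules with bases $\phi_{\nu,\nu+1},\phi_{\nu,\nu+3},\phi_{\nu,\nu+5},\dots$ and $\phi_{\nu,-\nu-1},\phi_{\nu,-\nu-3},\phi_{\nu,-\nu-5},\dots$, respectively. **Proposition.** 1. Let $f\neq0$ be a weakly holomorphic modular form of weight $k\in\frac12+\mathbb Z$ and type $\rho$. Then $\varpi(f,k)$ is contained in $A(\mathrm{Mp}_1(\mathbb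 R),\rho)$, is a Harish-Chandra module (its $K$-isotypic components are finite-dimensional), and is isomorphic to $\varpi^+(k-1)$. 2. Let $f$ be a harmonic weak Maaß form of weight $k\in\frac12+\mathbb Z$ and type $\rho$ that is not weakly holomorphic. Then $\varpi(f,k)$ is contained in $A(\mathrm{Mp}_1(\mathbb R),\rho)$, is a Harish-Chandra module, and fits into a nonsplit exact sequence $$0\longrightarrow\varpi^-(1-k)\longrightarrow\varpi(f,k)\longrightarrow\varpi^+(k-1)\longrightarrow0.$$ -/

import Mathlib

open scoped UpperHalfPlane MatrixGroups Manifold ContDiff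

noncomputable section

namespace Metaplectic

/-- The automorphy factor `c τ + d` of a real matrix of determinant one. -/
def den (g : SL(2, ℝ)) (τ : ℂ) : ℂ := (g 1 0 : ℂ) * τ + (g 1 1 : ℂ)

/-- The real metaplectic group: pairs of a matrix in `SL(2, ℝ)` and a holomorphic square root
of its automorphy factor on the upper half plane. -/
@[ext]
structure Mp where
  /-- the underlying matrix -/
  mat : SL(2, ℝ)
  /-- the chosen square root of `c τ + d` -/
  root : ℍ → ℂ
  holo : MDifferentiable 𝓘(ℂ) 𝓘(ℂ) root
  sq : ∀ τ : ℍ, root τ ^ 2 = den mat τ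

theorem den_eq_denom (g : SL(2, ℝ)) (τ : ℂ) : den g τ = UpperHalfPlane.denom (g : GL (Fin 2) ℝ) τ := by
  simp [den, UpperHalfPlane.denom]

theorem den_ne_zero (g : SL(2, ℝ)) (τ : ℍ) : den g τ ≠ 0 := by
  rw [den_eq_denom]; exact UpperHalfPlane.denom_ne_zero _ _

theorem den_mul (g h : SL(2, ℝ)) (τ : ℍ) : den (g * h) τ = den g (h • τ : ℍ) * den h τ := by
  have h0 := den_ne_zero h τ
  rw [UpperHalfPlane.coe_specialLinearGroup_apply]
  simp only [Algebra.algebraMap_self, RingHom.id_apply]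
  have : den h τ = (h 1 0 : ℂ) * τ + (h 1 1 : ℂ) := rfl
  rw [← this]
  simp only [den, Matrix.SpecialLinearGroup.coe_mul, Matrix.mul_apply, Fin.sum_univ_two] at *
  push_cast
  field_simp
  ring

theorem den_one (τ : ℂ) : den 1 τ = 1 := by simp [den]

theorem mdiff_smul (g : SL(2, ℝ)) : MDifferentiable 𝓘(ℂ) 𝓘(ℂ) (fun τ : ℍ ↦ g • τ) :=
  UpperHalfPlane.mdifferentiable_smul (g := (g : GL (Fin 2) ℝ)) (by simp)

theorem mdiff_den (g : SL(2, ℝ)) : MDifferentiable 𝓘(ℂ) 𝓘(ℂ) (fun τ : ℍ ↦ den g τ) := by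
  simp_rw [den_eq_denom]
  exact UpperHalfPlane.mdifferentiable_denom _

namespace Mp

instance : Mul Mp where
  mul x y :=
    { mat := x.mat * y.mat
      root := fun τ ↦ x.root (y.mat • τ) * y.root τ
      holo := (x.holo.comp (mdiff_smul y.mat)).mul y.holo
      sq := fun τ ↦ by rw [mul_pow, x.sq, y.sq, den_mul] }

instance : One Mp where
  one :=
    { mat := 1
      root := fun _ ↦ 1
      holo := mdifferentiable_const
      sq := fun τ ↦ by rw [den_one, one_pow] }

/-- The inverse of `(g, ω)` is `(g⁻¹, τ ↦ 1 / ω (g⁻¹ τ))`; here `1 / ω (g⁻¹ τ)` is written as the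
product of `ω (g⁻¹ τ)` and the automorphy factor of `g⁻¹`. -/
instance : Inv Mp where
  inv x :=
    { mat := x.mat⁻¹
      root := fun τ ↦ x.root (x.mat⁻¹ • τ) * den x.mat⁻¹ τ
      holo := (x.holo.comp (mdiff_smul x.mat⁻¹)).mul (mdiff_den x.mat⁻¹)
      sq := fun τ ↦ by
        have h := den_mul x.mat x.mat⁻¹ τ
        rw [mul_inv_cancel, den_one] at h
        rw [mul_pow, x.sq, pow_two, ← mul_assoc, ← h, one_mul] }

@[simp] theorem mat_mul (x y : Mp) : (x * y).mat = x.mat * y.mat := rfl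
@[simp] theorem root_mul (x y : Mp) (τ : ℍ) :
    (x * y).root τ = x.root (y.mat • τ) * y.root τ := rfl
@[simp] theorem mat_one : (1 : Mp).mat = 1 := rfl
@[simp] theorem root_one (τ : ℍ) : (1 : Mp).root τ = 1 := rfl
@[simp] theorem mat_inv (x : Mp) : x⁻¹.mat = x.mat⁻¹ := rfl
theorem root_inv (x : Mp) (τ : ℍ) :
    x⁻¹.root τ = x.root (x.mat⁻¹ • τ) * den x.mat⁻¹ τ := rfl

instance : Group Mp :=
  Group.ofLeftAxioms
    (fun x y z ↦ by
      ext τ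
      · simp [mul_assoc]
      · simp [mul_smul, mul_assoc])
    (fun x ↦ by ext τ <;> simp)
    (fun x ↦ by
      ext τ
      · simp
      · have h := den_mul x.mat⁻¹ x.mat τ
        rw [inv_mul_cancel, den_one, ← x.sq τ] at h
        rw [root_mul, root_inv, inv_smul_smul, root_one, h]
        ring)

theorem root_ne_zero (x : Mp) (τ : ℍ) : x.root τ ≠ 0 := by
  intro h
  have := x.sq τ
  rw [h] at this
  exact den_ne_zero x.mat τ (by simpa using this.symm)

/-- The projection onto `SL(2, ℝ)`. -/
def proj : Mp →* SL(2, ℝ) where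
  toFun := mat
  map_one' := rfl
  map_mul' _ _ := rfl

/-- The preimage of `SL(2, ℤ)`. -/
def integral : Subgroup Mp :=
  Subgroup.comap proj (Matrix.SpecialLinearGroup.map (Int.castRingHom ℝ)).range

/-- The maximal compact subgroup: the preimage of `SO(2)`. -/
def maxCompact : Subgroup Mp where
  carrier := {x | (x.mat : Matrix (Fin 2) (Fin 2) ℝ) * (x.mat : Matrix (Fin 2) (Fin 2) ℝ).transpose = 1}
  one_mem' := by simp
  mul_mem' {x y} hx hy := by
    simp only [Set.mem_ofPred_eq, mat_mul, Matrix.SpecialLinearGroup.coe_mul,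
      Matrix.transpose_mul] at *
    rw [Matrix.mul_assoc, ← Matrix.mul_assoc (y.mat : Matrix (Fin 2) (Fin 2) ℝ), hy,
      Matrix.one_mul, hx]
  inv_mem' {x} hx := by
    have h1 : (x.mat : Matrix (Fin 2) (Fin 2) ℝ) * ((x⁻¹).mat : Matrix (Fin 2) (Fin 2) ℝ) = 1 := by
      rw [← Matrix.SpecialLinearGroup.coe_mul]; simp
    have hx' : (x.mat : Matrix (Fin 2) (Fin 2) ℝ) * (x.mat : Matrix (Fin 2) (Fin 2) ℝ).transpose = 1 := hx
    have h2 : ((x⁻¹).mat : Matrix (Fin 2) (Fin 2) ℝ)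
        = (x.mat : Matrix (Fin 2) (Fin 2) ℝ).transpose := by
      have h3 := mul_eq_one_comm.mp h1
      calc ((x⁻¹).mat : Matrix (Fin 2) (Fin 2) ℝ)
          = (x⁻¹).mat * ((x.mat : Matrix (Fin 2) (Fin 2) ℝ)
            * (x.mat : Matrix (Fin 2) (Fin 2) ℝ).transpose) := by rw [hx', Matrix.mul_one]
        _ = _ := by rw [← Matrix.mul_assoc, h3, Matrix.one_mul]
    change ((x⁻¹).mat : Matrix (Fin 2) (Fin 2) ℝ)
      * ((x⁻¹).mat : Matrix (Fin 2) (Fin 2) ℝ).transpose = 1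
    rw [h2, Matrix.transpose_transpose]
    exact mul_eq_one_comm.mp hx'

theorem mdiff_sqrt_den (g : SL(2, ℝ)) :
    MDifferentiable 𝓘(ℂ) 𝓘(ℂ) (fun τ : ℍ ↦ den g τ ^ (1 / 2 : ℂ)) := by
  by_cases hc : g 1 0 = 0
  · simp only [den, hc, Complex.ofReal_zero, zero_mul, zero_add]
    exact mdifferentiable_const
  · intro τ
    have hs : den g τ ∈ Complex.slitPlane := by
      right
      simp [den, hc, τ.im_ne_zero]
    have hd : DifferentiableAt ℂ (fun z : ℂ ↦ z ^ (1 / 2 : ℂ)) (den g τ) :=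
      (hasStrictDerivAt_id (den g τ)).cpow_const hs |>.hasDerivAt.differentiableAt
    exact hd.mdifferentiableAt.comp τ (mdiff_den g τ)

/-- The element of the metaplectic group over `g` whose square root of `c τ + d` takes the
value `w` at `τ = i`. -/
def ofValue (g : SL(2, ℝ)) (w : ℂ) (hw : w ^ 2 = den g UpperHalfPlane.I) : Mp where
  mat := g
  root τ := w / den g UpperHalfPlane.I ^ (1 / 2 : ℂ) * den g τ ^ (1 / 2 : ℂ)
  holo := mdifferentiable_const.mul (mdiff_sqrt_den g)
  sq τ := by
    have h : ∀ z : ℂ, (z ^ (1 / 2 : ℂ)) ^ 2 = z := fun z ↦ by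
      rw [← Complex.cpow_nat_mul]; simp
    rw [mul_pow, div_pow, h, h, hw, div_self (den_ne_zero g _), one_mul]

/-- The lift of `g` to the metaplectic group by the principal branch of the square root. Over a
neighbourhood of the identity matrix this is the local inverse of the covering map. -/
def lift (g : SL(2, ℝ)) : Mp where
  mat := g
  root τ := den g τ ^ (1 / 2 : ℂ)
  holo := mdiff_sqrt_den g
  sq τ := by rw [← Complex.cpow_nat_mul]; simp

/-- The rotation matrix with rows `(cos θ, sin θ)` and `(-sin θ, cos θ)`. -/
def rotation (θ : ℝ) : SL(2, ℝ) :=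
  ⟨!![Real.cos θ, Real.sin θ; -Real.sin θ, Real.cos θ], by
    rw [Matrix.det_fin_two_of]; nlinarith [Real.sin_sq_add_cos_sq θ]⟩

/-- The element `k(θ)` over the rotation matrix, whose square root at `i` is `exp (-i θ / 2)`. -/
def k (θ : ℝ) : Mp :=
  ofValue (rotation θ) (Complex.exp (-Complex.I * θ / 2)) (by
    rw [← Complex.exp_nat_mul]
    have : ((2 : ℕ) : ℂ) * (-Complex.I * θ / 2) = ((-θ : ℝ) : ℂ) * Complex.I := by
      push_cast; ring
    rw [this, Complex.exp_mul_I]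
    simp [den, rotation]
    ring)

end Mp

section LieAlgebraAction

open LieAlgebra.SpecialLinear

theorem det_exp_of_trace_zero (X : Matrix (Fin 2) (Fin 2) ℝ) (hX : X.trace = 0) :
    (NormedSpace.exp X).det = 1 := by
  set J : Matrix (Fin 2) (Fin 2) ℝ := !![0, 1; -1, 0] with hJ
  have hJJ : J * (-J) = 1 := by
    ext i j; fin_cases i <;> fin_cases j <;> simp [hJ, Matrix.mul_apply, Fin.sum_univ_two]
  have hJu : IsUnit J := IsUnit.of_mul_eq_one _ hJJ
  have hJi : J⁻¹ = -J := Matrix.inv_eq_right_inv hJJ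
  have hd : X 1 1 = -X 0 0 := by
    rw [Matrix.trace_fin_two] at hX; linarith
  have h1 : J * X.transpose * J⁻¹ = -X := by
    rw [hJi]
    ext i j; fin_cases i <;> fin_cases j <;>
      simp [hJ, Matrix.mul_apply, Matrix.vecMul, dotProduct, Fin.sum_univ_two, hd]
  have h2 : NormedSpace.exp (-X) = J * (NormedSpace.exp X).transpose * J⁻¹ := by
    rw [← h1, Matrix.exp_conj _ _ hJu, Matrix.exp_transpose]
  have h3 : NormedSpace.exp X * NormedSpace.exp (-X) = 1 := by
    rw [← Matrix.exp_add_of_commute _ _ (Commute.neg_right (Commute.refl X)), add_neg_cancel,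
      NormedSpace.exp_zero]
  have h4 := congrFun (congrFun h3 0) 0
  rw [h2, hJi] at h4
  simp [hJ, Matrix.mul_apply, Matrix.vecMul, dotProduct, Fin.sum_univ_two] at h4
  rw [Matrix.det_fin_two]
  linarith

/-- The one-parameter subgroup `t ↦ exp (t X)` of `SL(2, ℝ)`. -/
def expSL (X : sl (Fin 2) ℝ) (t : ℝ) : SL(2, ℝ) :=
  ⟨NormedSpace.exp (t • (X : Matrix (Fin 2) (Fin 2) ℝ)), det_exp_of_trace_zero _ (by
    rw [Matrix.trace_smul, show (X : Matrix (Fin 2) (Fin 2) ℝ).trace = 0 from X.2, smul_zero])⟩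

/-- The matrix of real parts of an element of `sl(2, ℂ)`. -/
def rePart (Z : sl (Fin 2) ℂ) : sl (Fin 2) ℝ :=
  ⟨(Z : Matrix (Fin 2) (Fin 2) ℂ).map Complex.re, by
    have h : (Z : Matrix (Fin 2) (Fin 2) ℂ).trace = 0 := Z.2
    rw [Matrix.trace_fin_two] at h
    change Matrix.trace (Matrix.map (Z : Matrix (Fin 2) (Fin 2) ℂ) _) = 0
    rw [Matrix.trace_fin_two]
    simpa using congrArg Complex.re h⟩

/-- The matrix of imaginary parts of an element of `sl(2, ℂ)`. -/
def imPart (Z : sl (Fin 2) ℂ) : sl (Fin 2) ℝ :=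
  ⟨(Z : Matrix (Fin 2) (Fin 2) ℂ).map Complex.im, by
    have h : (Z : Matrix (Fin 2) (Fin 2) ℂ).trace = 0 := Z.2
    rw [Matrix.trace_fin_two] at h
    change Matrix.trace (Matrix.map (Z : Matrix (Fin 2) (Fin 2) ℂ) _) = 0
    rw [Matrix.trace_fin_two]
    simpa using congrArg Complex.im h⟩

variable {V : Type*} [NormedAddCommGroup V] [NormedSpace ℂ V]

/-- The right derivative `(X φ)(h) = ∂ₜ φ (h exp (t X))` at `t = 0`. For small `t` the element
`exp (t X)` of the metaplectic group is the principal lift of `exp (t X)` in `SL(2, ℝ)`. -/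
def rightDeriv (X : sl (Fin 2) ℝ) (φ : Mp → V) : Mp → V :=
  fun h ↦ deriv (fun t : ℝ ↦ φ (h * Mp.lift (expSL X t))) 0

/-- The action of `sl(2, ℂ)`, the complexified Lie algebra of the metaplectic group, on functions:
`(X + i Y) φ = X φ + i Y φ` for real `X` and `Y`. -/
def lieAct (Z : sl (Fin 2) ℂ) (φ : Mp → V) : Mp → V :=
  fun h ↦ rightDeriv (rePart Z) φ h + Complex.I • rightDeriv (imPart Z) φ h

/-- Right translation `(x φ)(h) = φ (h x)`. -/
def translate (x : Mp) (φ : Mp → V) : Mp → V := fun h ↦ φ (h * x)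

variable (V) in
/-- A space of functions on the metaplectic group that is stable under the Lie algebra and under
the maximal compact subgroup. -/
structure GKSubmodule where
  /-- the underlying complex vector space of functions -/
  space : Submodule ℂ (Mp → V)
  lie_mem : ∀ (Z : sl (Fin 2) ℂ) (φ : Mp → V), φ ∈ space → lieAct Z φ ∈ space
  translate_mem : ∀ x ∈ Mp.maxCompact, ∀ φ ∈ space, translate x φ ∈ space

/-- The `(𝔤, K)`-module generated by a function: the smallest stable space that contains it. -/
def generated (φ₀ : Mp → V) : GKSubmodule V where
  space := sInf {W | φ₀ ∈ W ∧ (∀ (Z : sl (Fin 2) ℂ) (φ : Mp → V), φ ∈ W → lieAct Z φ ∈ W) ∧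
    ∀ x ∈ Mp.maxCompact, ∀ φ ∈ W, translate x φ ∈ W}
  lie_mem Z φ h := by
    rw [Submodule.mem_sInf] at h ⊢
    exact fun W hW ↦ hW.2.1 Z φ (h W hW)
  translate_mem x hx φ h := by
    rw [Submodule.mem_sInf] at h ⊢
    exact fun W hW ↦ hW.2.2 x hx φ (h W hW)

variable {V₁ V₂ : Type*} [NormedAddCommGroup V₁] [NormedSpace ℂ V₁]
  [NormedAddCommGroup V₂] [NormedSpace ℂ V₂]

/-- A linear map between spaces of functions is a homomorphism of `(𝔤, K)`-modules if it commutes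
with the actions of the Lie algebra and of the maximal compact subgroup. -/
structure IsGKHom (W₁ : GKSubmodule V₁) (W₂ : GKSubmodule V₂) (T : W₁.space →ₗ[ℂ] W₂.space) :
    Prop where
  map_lie : ∀ (Z : sl (Fin 2) ℂ) (φ : W₁.space),
    (T ⟨lieAct Z φ, W₁.lie_mem Z φ φ.2⟩ : Mp → V₂) = lieAct Z (T φ)
  map_translate : ∀ (x : Mp) (hx : x ∈ Mp.maxCompact) (φ : W₁.space),
    (T ⟨translate x φ, W₁.translate_mem x hx φ φ.2⟩ : Mp → V₂) = translate x (T φ)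

/-- Isomorphism of `(𝔤, K)`-modules. -/
def GKIsomorphic (W₁ : GKSubmodule V₁) (W₂ : GKSubmodule V₂) : Prop :=
  ∃ T : W₁.space ≃ₗ[ℂ] W₂.space, IsGKHom W₁ W₂ T.toLinearMap

end LieAlgebraAction

section PrincipalSeries

/-- The function `φ_j`, `j = m / 2`, of the principal series with parameter `ν`: it is
determined by `φ_j (n(b) m(a, s) h) = s ^ (-2 j) |a| ^ (ν + 1) φ_j (h)` and
`φ_j (k(θ)) = exp (i j θ)`. -/
def phi (ν : ℂ) (m : ℤ) : Mp → ℂ := fun h ↦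
  (((h.mat • UpperHalfPlane.I : ℍ).im : ℝ) : ℂ) ^ ((ν + 1) / 2) *
    (h.root UpperHalfPlane.I / ((‖h.root UpperHalfPlane.I‖ : ℝ) : ℂ)) ^ (-m)

theorem k_smul_I {x : Mp} (hx : x ∈ Mp.maxCompact) : x.mat • UpperHalfPlane.I = UpperHalfPlane.I := by
  have h : (x.mat : Matrix (Fin 2) (Fin 2) ℝ) * (x.mat : Matrix (Fin 2) (Fin 2) ℝ).transpose = 1 := hx
  have h00 := congrFun (congrFun h 0) 0
  have h01 := congrFun (congrFun h 0) 1
  have h11 := congrFun (congrFun h 1) 1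
  have hd := x.mat.det_coe
  rw [Matrix.det_fin_two] at hd
  simp [Matrix.mul_apply, Fin.sum_univ_two] at h00 h01 h11
  have e1 : x.mat 0 0 = x.mat 1 1 := by
    linear_combination -(x.mat 0 0) * h11 + x.mat 1 0 * h01 + x.mat 1 1 * hd
  have e2 : x.mat 0 1 = -x.mat 1 0 := by
    linear_combination -(x.mat 0 1) * h11 + x.mat 1 1 * h01 - x.mat 1 0 * hd
  have hne := den_ne_zero x.mat UpperHalfPlane.I
  ext
  rw [UpperHalfPlane.coe_specialLinearGroup_apply]
  simp only [Algebra.algebraMap_self, RingHom.id_apply]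
  refine (div_eq_iff hne).mpr ?_
  rw [den, e1, e2]
  push_cast
  linear_combination (-(x.mat 1 0 : ℂ)) * Complex.I_mul_I

theorem norm_root_I {x : Mp} (hx : x ∈ Mp.maxCompact) : ‖x.root UpperHalfPlane.I‖ = 1 := by
  have h : (x.mat : Matrix (Fin 2) (Fin 2) ℝ) * (x.mat : Matrix (Fin 2) (Fin 2) ℝ).transpose = 1 := hx
  have h11 := congrFun (congrFun h 1) 1
  simp [Matrix.mul_apply, Fin.sum_univ_two] at h11
  have h1 : Complex.normSq (den x.mat UpperHalfPlane.I) = 1 := by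
    rw [Complex.normSq_apply]
    simpa [den, add_comm] using h11
  have h2 : ‖x.root UpperHalfPlane.I‖ ^ 4 = 1 := by
    rw [← h1, ← x.sq, Complex.normSq_eq_norm_sq, norm_pow]
    ring
  exact (pow_eq_one_iff_of_nonneg (norm_nonneg _) (by norm_num)).mp h2

theorem im_smul_I (h : Mp) :
    (h.mat • UpperHalfPlane.I : ℍ).im = (‖h.root UpperHalfPlane.I‖ ^ 4)⁻¹ := by
  have h1 : ‖h.root UpperHalfPlane.I‖ ^ 4 = Complex.normSq (den h.mat UpperHalfPlane.I) := by
    rw [← h.sq, Complex.normSq_eq_norm_sq, norm_pow]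
    ring
  have h2 := UpperHalfPlane.im_smul_eq_div_normSq (h.mat : GL (Fin 2) ℝ) UpperHalfPlane.I
  rw [h1, den_eq_denom]
  simpa using! h2

theorem phi_eq (ν : ℂ) (m : ℤ) (h : Mp) :
    phi ν m h = Complex.exp (-2 * (ν + 1) * (Real.log ‖h.root UpperHalfPlane.I‖ : ℝ)) *
      (h.root UpperHalfPlane.I / ((‖h.root UpperHalfPlane.I‖ : ℝ) : ℂ)) ^ (-m) := by
  have hp : 0 < ‖h.root UpperHalfPlane.I‖ := norm_pos_iff.mpr (h.root_ne_zero _)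
  rw [phi, im_smul_I, Complex.cpow_def_of_ne_zero (by simpa using! hp.ne'),
    ← Complex.ofReal_log (by positivity), Real.log_inv, Real.log_pow]
  congr 2
  push_cast
  ring

theorem phi_translate (ν : ℂ) (m : ℤ) {x : Mp} (hx : x ∈ Mp.maxCompact) :
    translate x (phi ν m) = (x.root UpperHalfPlane.I ^ (-m)) • phi ν m := by
  funext h
  simp only [translate, Pi.smul_apply, smul_eq_mul]
  rw [phi_eq, phi_eq]
  simp only [Mp.root_mul, k_smul_I hx, norm_mul, norm_root_I hx, mul_one]
  rw [mul_div_right_comm, mul_zpow]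
  ring

/-- The functions `φ_j` restrict to the characters of the maximal compact subgroup. -/
theorem phi_k (ν : ℂ) (m : ℤ) (θ : ℝ) :
    phi ν m (Mp.k θ) = Complex.exp (Complex.I * ((m : ℂ) / 2) * θ) := by
  have hr : (Mp.k θ).root UpperHalfPlane.I = Complex.exp (-Complex.I * θ / 2) := by
    have h0 : den (Mp.rotation θ) UpperHalfPlane.I ^ (1 / 2 : ℂ) ≠ 0 := by
      rw [Complex.cpow_ne_zero_iff]
      exact Or.inl (den_ne_zero _ _)
    simp only [Mp.k, Mp.ofValue]
    exact div_mul_cancel₀ _ h0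
  have hn : ‖Complex.exp (-Complex.I * θ / 2)‖ = 1 := by
    rw [Complex.norm_exp]; simp
  rw [phi_eq, hr, hn]
  simp only [Real.log_one, Complex.ofReal_zero, mul_zero, Complex.exp_zero, one_mul,
    Complex.ofReal_one, div_one]
  rw [← Complex.exp_int_mul]
  congr 1
  push_cast
  ring

/-- The transformation behaviour of `φ_j` under upper triangular elements `(g, ω)`: with
`a = g 0 0` and `s` the sign of the constant `ω`, it is multiplied by
`|a| ^ (ν + 1) s ^ (-2 j)`. -/
theorem phi_upper_mul (ν : ℂ) (m : ℤ) (p h : Mp) (hp : p.mat 1 0 = 0) :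
    phi ν m (p * h) = ((|p.mat 0 0| : ℝ) : ℂ) ^ (ν + 1) *
      (p.root UpperHalfPlane.I / ((‖p.root UpperHalfPlane.I‖ : ℝ) : ℂ)) ^ (-m) * phi ν m h := by
  have hc : ∀ τ : ℍ, p.root τ ^ 2 = (p.mat 1 1 : ℂ) := fun τ ↦ by
    rw [p.sq, den, hp]; simp
  have hd := p.mat.det_coe
  rw [Matrix.det_fin_two] at hd
  have hd' : p.mat 0 0 * p.mat 1 1 = 1 := by
    linear_combination hd + p.mat 0 1 * hp
  -- the holomorphic function `p.root` has constant square, hence is constant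
  have hconst : p.root (h.mat • UpperHalfPlane.I) = p.root UpperHalfPlane.I := by
    have hne := p.root_ne_zero UpperHalfPlane.I
    have hcon : Set.EqOn (fun τ : ℍ ↦ p.root τ) (fun _ : ℍ ↦ p.root UpperHalfPlane.I) Set.univ := by
      refine isPreconnected_univ.eq_of_sq_eq p.holo.continuous.continuousOn
        continuousOn_const (fun τ _ ↦ ?_) (fun _ ↦ hne) (Set.mem_univ UpperHalfPlane.I) rfl
      simp only [Pi.pow_apply]
      rw [hc, hc]
    exact hcon (Set.mem_univ _)
  have hnp : 0 < ‖p.root UpperHalfPlane.I‖ := norm_pos_iff.mpr (p.root_ne_zero _)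
  have hnh : 0 < ‖h.root UpperHalfPlane.I‖ := norm_pos_iff.mpr (h.root_ne_zero _)
  have ha : |p.mat 0 0| = (‖p.root UpperHalfPlane.I‖ ^ 2)⁻¹ := by
    rw [← norm_pow, hc, Complex.norm_real, Real.norm_eq_abs, ← abs_inv]
    congr 1
    exact eq_inv_of_mul_eq_one_left hd'
  rw [phi_eq, phi_eq, Mp.root_mul, hconst, norm_mul, Real.log_mul hnp.ne' hnh.ne', ha,
    Complex.cpow_def_of_ne_zero (by simpa using! hnp.ne'), ← Complex.ofReal_log (by positivity),
    Real.log_inv, Real.log_pow, Complex.ofReal_mul, mul_div_mul_comm, mul_zpow]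
  have e : Complex.exp (-2 * (ν + 1) * ((Real.log ‖p.root UpperHalfPlane.I‖
      + Real.log ‖h.root UpperHalfPlane.I‖ : ℝ) : ℂ)) =
      Complex.exp (((-(((2 : ℕ) : ℝ) * Real.log ‖p.root UpperHalfPlane.I‖) : ℝ) : ℂ) * (ν + 1)) *
      Complex.exp (-2 * (ν + 1) * (Real.log ‖h.root UpperHalfPlane.I‖ : ℝ)) := by
    rw [← Complex.exp_add]
    congr 1
    push_cast
    ring
  rw [e]
  ring

theorem phi_of_exp (ν : ℂ) (m : ℤ) (h h' : Mp) (L : ℂ)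
    (hL : h'.root UpperHalfPlane.I = h.root UpperHalfPlane.I * Complex.exp (L / 2)) :
    phi ν m h' = phi ν m h * Complex.exp (-(ν + 1) * L.re - Complex.I * (m / 2) * L.im) := by
  have hp : ‖h.root UpperHalfPlane.I‖ ≠ 0 := (norm_pos_iff.mpr (h.root_ne_zero _)).ne'
  have hn : ‖Complex.exp (L / 2)‖ = Real.exp (L.re / 2) := by
    rw [Complex.norm_exp]; simp
  have hq : Complex.exp (L / 2) / ((Real.exp (L.re / 2) : ℝ) : ℂ)
      = Complex.exp (Complex.I * L.im / 2) := by
    rw [Complex.ofReal_exp, ← Complex.exp_sub]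
    congr 1
    push_cast
    nth_rewrite 1 [← Complex.re_add_im L]
    ring
  rw [phi_eq, phi_eq, hL, norm_mul, hn, Real.log_mul hp (Real.exp_ne_zero _), Real.log_exp,
    Complex.ofReal_mul, mul_div_mul_comm, hq, mul_zpow, ← Complex.exp_int_mul]
  have : ∀ a b c d e : ℂ, a * (b * c) = d * b * e ↔ b * (a * c) = b * (d * e) := by
    intros; constructor <;> intro h <;> linear_combination h
  rw [this]
  congr 1
  rw [← Complex.exp_add, ← Complex.exp_add]
  congr 1
  push_cast
  ring

theorem hasDerivAt_expSL (X : LieAlgebra.SpecialLinear.sl (Fin 2) ℝ) (i j : Fin 2) :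
    HasDerivAt (fun t : ℝ ↦ (expSL X t) i j) ((X : Matrix (Fin 2) (Fin 2) ℝ) i j) 0 := by
  let _ : NormedRing (Matrix (Fin 2) (Fin 2) ℝ) := Matrix.linftyOpNormedRing
  let _ : NormedAlgebra ℝ (Matrix (Fin 2) (Fin 2) ℝ) := Matrix.linftyOpNormedAlgebra
  have h := hasDerivAt_exp_smul_const (𝕂 := ℝ) (X : Matrix (Fin 2) (Fin 2) ℝ) (0 : ℝ)
  rw [zero_smul, NormedSpace.exp_zero, one_mul] at h
  exact (hasDerivAt_pi.mp ((hasDerivAt_pi.mp h) i)) j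

theorem expSL_zero (X : LieAlgebra.SpecialLinear.sl (Fin 2) ℝ) : expSL X 0 = 1 := by
  ext i j
  simp [expSL, NormedSpace.exp_zero]

theorem hasDerivAt_den (h : Mp) (X : LieAlgebra.SpecialLinear.sl (Fin 2) ℝ) :
    HasDerivAt (fun t : ℝ ↦ den (h.mat * expSL X t) UpperHalfPlane.I)
      (((h.mat 1 0 * X.1 0 0 + h.mat 1 1 * X.1 1 0 : ℝ) : ℂ) * Complex.I
        + ((h.mat 1 0 * X.1 0 1 + h.mat 1 1 * X.1 1 1 : ℝ) : ℂ)) 0 := by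
  have e := hasDerivAt_expSL X
  have h1 := (((e 0 0).const_mul (h.mat 1 0)).add ((e 1 0).const_mul (h.mat 1 1))).ofReal_comp
  have h2 := (((e 0 1).const_mul (h.mat 1 0)).add ((e 1 1).const_mul (h.mat 1 1))).ofReal_comp
  refine ((h1.mul_const Complex.I).add h2).congr_of_eventuallyEq (.of_forall fun t ↦ ?_)
  simp [den, Matrix.SpecialLinearGroup.coe_mul, Matrix.mul_apply, Fin.sum_univ_two]

theorem continuousAt_root (h : Mp) (X : LieAlgebra.SpecialLinear.sl (Fin 2) ℝ) :
    ContinuousAt (fun t : ℝ ↦ (h * Mp.lift (expSL X t)).root UpperHalfPlane.I) 0 := by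
  have e : ∀ i j, ContinuousAt (fun t : ℝ ↦ ((expSL X t i j : ℝ) : ℂ)) 0 := fun i j ↦
    Complex.continuous_ofReal.continuousAt.comp (hasDerivAt_expSL X i j).continuousAt
  have hd : ContinuousAt (fun t : ℝ ↦ den (expSL X t) UpperHalfPlane.I) 0 :=
    ((e 1 0).mul continuousAt_const).add (e 1 1)
  have hs : ContinuousAt (fun t : ℝ ↦ expSL X t • UpperHalfPlane.I) 0 := by
    rw [UpperHalfPlane.isOpenEmbedding_coe.isInducing.continuousAt_iff]
    have : ((fun z : ℍ ↦ (z : ℂ)) ∘ fun t : ℝ ↦ expSL X t • UpperHalfPlane.I) = fun t ↦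
        ((expSL X t 0 0 : ℂ) * Complex.I + (expSL X t 0 1 : ℂ)) / den (expSL X t) UpperHalfPlane.I := by
      funext t
      exact UpperHalfPlane.coe_specialLinearGroup_apply _ _
    rw [this]
    exact (((e 0 0).mul continuousAt_const).add (e 0 1)).div hd (den_ne_zero _ _)
  have hr : ContinuousAt (fun t : ℝ ↦ h.root (expSL X t • UpperHalfPlane.I)) 0 :=
    ContinuousAt.comp (f := fun t : ℝ ↦ expSL X t • UpperHalfPlane.I)
      h.holo.continuous.continuousAt hs
  refine hr.mul (hd.cpow continuousAt_const ?_)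
  rw [expSL_zero, den_one]
  exact Complex.one_mem_slitPlane

theorem root_eventually (h : Mp) (X : LieAlgebra.SpecialLinear.sl (Fin 2) ℝ) :
    ∀ᶠ t : ℝ in nhds 0, (h * Mp.lift (expSL X t)).root UpperHalfPlane.I
      = h.root UpperHalfPlane.I * Complex.exp (Complex.log (den (h.mat * expSL X t)
        UpperHalfPlane.I / den h.mat UpperHalfPlane.I) / 2) := by
  set J : ℝ → ℂ := fun t ↦ (h * Mp.lift (expSL X t)).root UpperHalfPlane.I with hJ
  set z : ℝ → ℂ := fun t ↦ den (h.mat * expSL X t) UpperHalfPlane.I with hz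
  set z0 : ℂ := den h.mat UpperHalfPlane.I with hz0
  have hz0n : z0 ≠ 0 := den_ne_zero _ _
  have hzn : ∀ t, z t ≠ 0 := fun t ↦ den_ne_zero _ _
  have hz00 : z 0 = z0 := by simp [hz, expSL_zero, hz0]
  have hsq : ∀ t, J t ^ 2 = z t := fun t ↦ (h * Mp.lift (expSL X t)).sq _
  have hJ0 : J 0 = h.root UpperHalfPlane.I := by
    simp [hJ, expSL_zero, Mp.lift, den_one]
  have hr0 := h.root_ne_zero UpperHalfPlane.I
  set q : ℝ → ℂ := fun t ↦ J t / (h.root UpperHalfPlane.I * Complex.exp (Complex.log (z t / z0) / 2))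
  have hq2 : ∀ t, q t ^ 2 = 1 := fun t ↦ by
    simp only [q]
    rw [div_pow, hsq, mul_pow, h.sq, ← Complex.exp_nat_mul]
    have : ((2 : ℕ) : ℂ) * (Complex.log (z t / z0) / 2) = Complex.log (z t / z0) := by
      push_cast; ring
    rw [this, Complex.exp_log (div_ne_zero (hzn t) hz0n), mul_div_cancel₀ _ hz0n,
      div_self (hzn t)]
  have hq0 : q 0 = 1 := by
    simp only [q]
    rw [hJ0, hz00, div_self hz0n]
    simp [hr0]
  have hzc : ContinuousAt z 0 := (hasDerivAt_den h X).continuousAt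
  have hqc : ContinuousAt q 0 := by
    refine (continuousAt_root h X).div (continuousAt_const.mul ?_)
      (mul_ne_zero hr0 (Complex.exp_ne_zero _))
    refine Complex.continuous_exp.continuousAt.comp (ContinuousAt.div_const ?_ 2)
    refine (hzc.div_const z0).clog ?_
    rw [hz00, div_self hz0n]
    exact Complex.one_mem_slitPlane
  have hne : ∀ᶠ t in nhds 0, q t ≠ -1 := hqc.eventually_ne (by rw [hq0]; norm_num)
  filter_upwards [hne] with t ht
  have : q t = 1 := (sq_eq_sq_iff_eq_or_eq_neg.mp ((hq2 t).trans (one_pow 2).symm)).resolve_right ht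
  exact (div_eq_one_iff_eq (mul_ne_zero hr0 (Complex.exp_ne_zero _))).mp this

theorem phi_add_four (ν : ℂ) (m : ℤ) (h : Mp) :
    phi ν (m + 4) h = phi ν m h * (starRingEnd ℂ (den h.mat UpperHalfPlane.I)
      / den h.mat UpperHalfPlane.I) := by
  have hr := h.root_ne_zero UpperHalfPlane.I
  have hn : ((‖h.root UpperHalfPlane.I‖ : ℝ) : ℂ) ≠ 0 := by simpa using! hr
  rw [phi_eq, phi_eq, neg_add, zpow_add₀ (div_ne_zero hr hn), ← mul_assoc, ← h.sq]
  congr 1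
  have h2 : ((‖h.root UpperHalfPlane.I‖ : ℝ) : ℂ) ^ 2
      = h.root UpperHalfPlane.I * starRingEnd ℂ (h.root UpperHalfPlane.I) := by
    rw [Complex.mul_conj, Complex.normSq_eq_norm_sq]; push_cast; ring
  have h4 : ((‖h.root UpperHalfPlane.I‖ : ℝ) : ℂ) ^ 4
      = h.root UpperHalfPlane.I ^ 2 * starRingEnd ℂ (h.root UpperHalfPlane.I) ^ 2 := by
    rw [← mul_pow, ← h2]; ring
  rw [zpow_neg, show (4 : ℤ) = ((4 : ℕ) : ℤ) from rfl, zpow_natCast, div_pow, inv_div, h4, map_pow]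
  field_simp

theorem phi_sub_four (ν : ℂ) (m : ℤ) (h : Mp) :
    phi ν (m - 4) h = phi ν m h * (den h.mat UpperHalfPlane.I
      / starRingEnd ℂ (den h.mat UpperHalfPlane.I)) := by
  have h1 := phi_add_four ν (m - 4) h
  have h2 : den h.mat UpperHalfPlane.I ≠ 0 := den_ne_zero _ _
  have h3 : starRingEnd ℂ (den h.mat UpperHalfPlane.I) ≠ 0 := by simpa using h2
  rw [sub_add_cancel] at h1
  rw [h1]
  field_simp

theorem phi_deriv_identity (ν : ℂ) (m : ℤ) (z : ℂ) (a b c : ℝ) (hz : z ≠ 0) :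
    -(ν + 1) * (((((z.im * a + z.re * c : ℝ) : ℂ) * Complex.I
        + ((z.im * b + z.re * (-a) : ℝ) : ℂ)) / z).re : ℂ)
      - Complex.I * (m / 2) * (((((z.im * a + z.re * c : ℝ) : ℂ) * Complex.I
        + ((z.im * b + z.re * (-a) : ℝ) : ℂ)) / z).im : ℂ)
      = (-Complex.I * (m / 2) * ((c - b : ℝ) / 2))
        + ((ν + 1 + m / 2) / 2 * ((a : ℝ) - Complex.I * (c + b : ℝ) / 2))
          * (starRingEnd ℂ z / z)
        + ((ν + 1 - m / 2) / 2 * ((a : ℝ) + Complex.I * (c + b : ℝ) / 2))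
          * (z / starRingEnd ℂ z) := by
  have hcn : starRingEnd ℂ z ≠ 0 := by simpa using hz
  have hI : Complex.I ^ 2 = -1 := Complex.I_sq
  rw [Complex.re_eq_add_conj (_ / z), Complex.im_eq_sub_conj (_ / z)]
  simp only [map_div₀, map_add, map_mul, Complex.conj_ofReal, Complex.conj_I]
  push_cast
  rw [Complex.re_eq_add_conj z, Complex.im_eq_sub_conj z]
  set w := starRingEnd ℂ z
  have hn : Complex.I ≠ 0 := Complex.I_ne_zero
  field_simp
  ring_nf
  simp only [hI]
  ring

theorem hasDerivAt_phi (ν : ℂ) (m : ℤ) (X : LieAlgebra.SpecialLinear.sl (Fin 2) ℝ) (h : Mp) :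
    HasDerivAt (fun t : ℝ ↦ phi ν m (h * Mp.lift (expSL X t)))
      ((-Complex.I * (m / 2) * ((X.1 1 0 - X.1 0 1 : ℝ) / 2)) * phi ν m h
        + ((ν + 1 + m / 2) / 2 * ((X.1 0 0 : ℝ) - Complex.I * (X.1 1 0 + X.1 0 1 : ℝ) / 2))
          * phi ν (m + 4) h
        + ((ν + 1 - m / 2) / 2 * ((X.1 0 0 : ℝ) + Complex.I * (X.1 1 0 + X.1 0 1 : ℝ) / 2))
          * phi ν (m - 4) h) 0 := by
  have hz0n : den h.mat UpperHalfPlane.I ≠ 0 := den_ne_zero _ _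
  have htr : X.1 1 1 = - X.1 0 0 := by
    have : Matrix.trace X.1 = 0 := X.2
    rw [Matrix.trace_fin_two] at this
    linarith
  have hz := (hasDerivAt_den h X).div_const (den h.mat UpperHalfPlane.I)
  have hL := hz.clog_real (by
    rw [expSL_zero, mul_one, div_self hz0n]; exact Complex.one_mem_slitPlane)
  rw [expSL_zero, mul_one, div_self hz0n, div_one] at hL
  have hre := (Complex.reCLM.hasFDerivAt.comp_hasDerivAt (0 : ℝ) hL).ofReal_comp
  have him := (Complex.imCLM.hasFDerivAt.comp_hasDerivAt (0 : ℝ) hL).ofReal_comp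
  have hE := (((hre.const_mul (-(ν + 1))).sub
    (him.const_mul (Complex.I * (m / 2)))).cexp).const_mul (phi ν m h)
  have hev : (fun t : ℝ ↦ phi ν m (h * Mp.lift (expSL X t))) =ᶠ[nhds 0] _ :=
    (root_eventually h X).mono fun t ht ↦ phi_of_exp ν m h _ _ ht
  refine (hE.congr_of_eventuallyEq hev).congr_deriv ?_
  have hre0 : (den h.mat UpperHalfPlane.I).re = h.mat 1 1 := by simp [den]
  have him0 : (den h.mat UpperHalfPlane.I).im = h.mat 1 0 := by simp [den]
  have e0 : den (h.mat * expSL X 0) UpperHalfPlane.I / den h.mat UpperHalfPlane.I = 1 := by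
    rw [expSL_zero, mul_one, div_self hz0n]
  have alg := phi_deriv_identity ν m (den h.mat UpperHalfPlane.I) (X.1 0 0) (X.1 0 1) (X.1 1 0) hz0n
  rw [hre0, him0, ← htr] at alg
  rw [phi_add_four, phi_sub_four]
  have ex : ∀ u w : ℂ, u = 0 → phi ν m h * (Complex.exp u * w) = phi ν m h * w := by
    rintro _ w rfl
    rw [Complex.exp_zero, one_mul]
  refine (ex _ _ ?_).trans ((congrArg (phi ν m h * ·) alg).trans ?_)
  · change -(ν + 1) * ((Complex.log (den (h.mat * expSL X 0) UpperHalfPlane.I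
      / den h.mat UpperHalfPlane.I)).re : ℂ) - Complex.I * (m / 2) *
      ((Complex.log (den (h.mat * expSL X 0) UpperHalfPlane.I
      / den h.mat UpperHalfPlane.I)).im : ℂ) = 0
    rw [e0]
    simp
  · ring

theorem lieAct_phi_mem (ν : ℂ) (S : Set ℤ)
    (hS : ∀ m ∈ S, (ν + 1 + m / 2 = 0 ∨ m + 4 ∈ S) ∧ (ν + 1 - m / 2 = 0 ∨ m - 4 ∈ S))
    (Z : LieAlgebra.SpecialLinear.sl (Fin 2) ℂ) (φ : Mp → ℂ)
    (hφ : φ ∈ Submodule.span ℂ (phi ν '' S)) :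
    lieAct Z φ ∈ Submodule.span ℂ (phi ν '' S) := by
  have key : ∀ X : LieAlgebra.SpecialLinear.sl (Fin 2) ℝ, ∃ ψ ∈ Submodule.span ℂ (phi ν '' S),
      ∀ h, HasDerivAt (fun t : ℝ ↦ φ (h * Mp.lift (expSL X t))) (ψ h) 0 := by
    intro X
    induction hφ using Submodule.span_induction with
    | mem φ h =>
      obtain ⟨m, hm, rfl⟩ := h
      obtain ⟨h1, h2⟩ := hS m hm
      refine ⟨_, ?_, fun h ↦ hasDerivAt_phi ν m X h⟩
      refine Submodule.add_mem _ (Submodule.add_mem _ ?_ ?_) ?_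
      · exact Submodule.smul_mem _ _ (Submodule.subset_span ⟨m, hm, rfl⟩)
      · rcases h1 with h1 | h1
        · simp only [h1, zero_div, zero_mul]
          exact Submodule.zero_mem _
        · exact Submodule.smul_mem _ _ (Submodule.subset_span ⟨_, h1, rfl⟩)
      · rcases h2 with h2 | h2
        · simp only [h2, zero_div, zero_mul]
          exact Submodule.zero_mem _
        · exact Submodule.smul_mem _ _ (Submodule.subset_span ⟨_, h2, rfl⟩)
    | zero => exact ⟨0, Submodule.zero_mem _, fun h ↦ hasDerivAt_const _ _⟩
    | add φ₁ φ₂ _ _ h₁ h₂ =>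
      obtain ⟨ψ₁, m₁, d₁⟩ := h₁
      obtain ⟨ψ₂, m₂, d₂⟩ := h₂
      exact ⟨_, Submodule.add_mem _ m₁ m₂, fun h ↦ (d₁ h).add (d₂ h)⟩
    | smul c φ₁ _ h₁ =>
      obtain ⟨ψ₁, m₁, d₁⟩ := h₁
      exact ⟨_, Submodule.smul_mem _ c m₁, fun h ↦ (d₁ h).const_mul c⟩
  obtain ⟨ψ₁, m₁, d₁⟩ := key (rePart Z)
  obtain ⟨ψ₂, m₂, d₂⟩ := key (imPart Z)
  have : lieAct Z φ = ψ₁ + Complex.I • ψ₂ := by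
    funext h
    simp only [lieAct, rightDeriv, (d₁ h).deriv, (d₂ h).deriv, Pi.add_apply, Pi.smul_apply]
  rw [this]
  exact Submodule.add_mem _ m₁ (Submodule.smul_mem _ _ m₂)

theorem translate_phi_mem (ν : ℂ) (S : Set ℤ) (x : Mp) (hx : x ∈ Mp.maxCompact) (φ : Mp → ℂ)
    (hφ : φ ∈ Submodule.span ℂ (phi ν '' S)) :
    translate x φ ∈ Submodule.span ℂ (phi ν '' S) := by
  induction hφ using Submodule.span_induction with
  | mem φ h =>
    obtain ⟨m, hm, rfl⟩ := h
    rw [phi_translate ν m hx]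
    exact Submodule.smul_mem _ _ (Submodule.subset_span ⟨m, hm, rfl⟩)
  | zero => exact Submodule.zero_mem _
  | add φ₁ φ₂ _ _ h₁ h₂ => exact Submodule.add_mem _ h₁ h₂
  | smul c φ₁ _ h₁ => exact Submodule.smul_mem _ c h₁

/-- The module `ϖ⁺(ν)` for `ν = n / 2`, spanned by `φ_{ν+1}, φ_{ν+3}, φ_{ν+5}, …`. -/
def varpiPlus (n : ℤ) : GKSubmodule ℂ where
  space := Submodule.span ℂ (phi (n / 2) '' {m | ∃ r : ℕ, m = n + 2 + 4 * r})
  lie_mem := lieAct_phi_mem _ _ (by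
    rintro _ ⟨r, rfl⟩
    refine ⟨Or.inr ⟨r + 1, by push_cast; ring⟩, ?_⟩
    rcases r with _ | r
    · left; push_cast; ring
    · right; exact ⟨r, by push_cast; ring⟩)
  translate_mem := translate_phi_mem _ _

/-- The module `ϖ⁻(ν)` for `ν = n / 2`, spanned by `φ_{-ν-1}, φ_{-ν-3}, φ_{-ν-5}, …`. -/
def varpiMinus (n : ℤ) : GKSubmodule ℂ where
  space := Submodule.span ℂ (phi (n / 2) '' {m | ∃ r : ℕ, m = -n - 2 - 4 * r})
  lie_mem := lieAct_phi_mem _ _ (by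
    rintro _ ⟨r, rfl⟩
    refine ⟨?_, Or.inr ⟨r + 1, by push_cast; ring⟩⟩
    rcases r with _ | r
    · left; push_cast; ring
    · right; exact ⟨r, by push_cast; ring⟩)
  translate_mem := translate_phi_mem _ _

end PrincipalSeries

section Forms

variable {V : Type*} [NormedAddCommGroup V] [NormedSpace ℂ V]

/-- The slash action of weight `κ / 2`: `(f |_{κ/2} (g, ω)) (τ) = ω (τ) ^ (-κ) f (g τ)`. -/
def slash (κ : ℤ) (f : ℍ → V) (x : Mp) : ℍ → V :=
  fun τ ↦ (x.root τ ^ (-κ)) • f (x.mat • τ)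

/-- Smoothness (in the real sense) of a function on the upper half plane. -/
def IsSmooth (f : ℍ → V) : Prop :=
  ContDiffOn ℝ ∞ (f ∘ UpperHalfPlane.ofComplex) {z : ℂ | 0 < z.im}

/-- The derivative of `f` at `τ` in the real direction `w`. -/
def dirDeriv (w : ℂ) (f : ℍ → V) : ℍ → V :=
  fun τ ↦ fderiv ℝ (f ∘ UpperHalfPlane.ofComplex) (τ : ℂ) w

/-- `∂_τ = (∂_u - i ∂_v) / 2` for `τ = u + i v`. -/
def dTau (f : ℍ → V) : ℍ → V :=
  fun τ ↦ (1 / 2 : ℂ) • (dirDeriv 1 f τ - Complex.I • dirDeriv Complex.I f τ)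

/-- `∂_{τ̄} = (∂_u + i ∂_v) / 2` for `τ = u + i v`. -/
def dTauBar (f : ℍ → V) : ℍ → V :=
  fun τ ↦ (1 / 2 : ℂ) • (dirDeriv 1 f τ + Complex.I • dirDeriv Complex.I f τ)

/-- The raising operator `R_k = 2 i ∂_τ + k v⁻¹` of weight `k = κ / 2`. -/
def raising (κ : ℤ) (f : ℍ → V) : ℍ → V :=
  fun τ ↦ (2 * Complex.I) • dTau f τ + ((κ : ℂ) / 2 * ((τ.im : ℝ) : ℂ)⁻¹) • f τ

/-- The lowering operator `L = -2 i v² ∂_{τ̄}` (which does not depend on the weight). -/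
def lowering (f : ℍ → V) : ℍ → V :=
  fun τ ↦ (-2 * Complex.I * ((τ.im : ℝ) : ℂ) ^ 2) • dTauBar f τ

/-- The Laplace operator `Δ_k = -R_{k-2} L_k` of weight `k = κ / 2`. -/
def laplace (κ : ℤ) (f : ℍ → V) : ℍ → V :=
  fun τ ↦ -raising (κ - 4) (lowering f) τ

/-- Exponential growth at the cusps: there is a real `a` such that for every integral `γ` one has
`f |_k γ = O (exp (a v))` as `v → ∞`, uniformly in `u`. -/
def ExpGrowthAtCusps (κ : ℤ) (f : ℍ → V) : Prop :=
  ∃ a : ℝ, ∀ γ ∈ Mp.integral,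
    slash κ f γ =O[UpperHalfPlane.atImInfty] fun τ : ℍ ↦ Real.exp (a * τ.im)

/-- Modularity of weight `k = κ / 2` and type `ρ`: `ρ(γ)⁻¹ (f |_k γ) = f` for all `γ ∈ Γ`. -/
def IsModular (Γ : Subgroup Mp) (ρ : Representation ℂ Γ V) (κ : ℤ) (f : ℍ → V) : Prop :=
  ∀ (γ : Γ) (τ : ℍ), ρ γ⁻¹ (slash κ f γ τ) = f τ

/-- Harmonic weak Maass forms of weight `k = κ / 2` and type `ρ`. -/
structure IsHarmonicWeakMaassForm (Γ : Subgroup Mp) (ρ : Representation ℂ Γ V) (κ : ℤ)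
    (f : ℍ → V) : Prop where
  smooth : IsSmooth f
  harmonic : laplace κ f = 0
  modular : IsModular Γ ρ κ f
  growth : ExpGrowthAtCusps κ f

/-- Weakly holomorphic modular forms of weight `k = κ / 2` and type `ρ`: holomorphic, modular, and
with poles of finite order at the cusps, that is, of at most exponential growth there. -/
structure IsWeaklyHolomorphic (Γ : Subgroup Mp) (ρ : Representation ℂ Γ V) (κ : ℤ)
    (f : ℍ → V) : Prop where
  holo : DifferentiableOn ℂ (f ∘ UpperHalfPlane.ofComplex) {z : ℂ | 0 < z.im}
  modular : IsModular Γ ρ κ f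
  growth : ExpGrowthAtCusps κ f

/-- The pullback `f̃ (g, ω) = ω(i) ^ (-2k) f (g i) = (f |_k (g, ω)) (i)`, `k = κ / 2`. -/
def pullback (κ : ℤ) (f : ℍ → V) : Mp → V := fun x ↦ slash κ f x UpperHalfPlane.I

/-- The `(𝔤, K)`-module `ϖ(f, k)`, `k = κ / 2`, generated by the pullback of `f`. -/
def varpi (κ : ℤ) (f : ℍ → V) : GKSubmodule V := generated (pullback κ f)

/-- Smoothness of a function on the metaplectic group, expressed in the Iwasawa coordinates
`(u + i v, θ) ↦ n(u) m(√v, 1) k(θ)`, a smooth covering of the group by `ℍ × ℝ`. -/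
def IsSmoothMp (φ : Mp → V) : Prop :=
  ContDiffOn ℝ ∞ (fun p : ℂ × ℝ ↦
    φ (Mp.lift (UpperHalfPlane.ofComplex p.1).toSL2R * Mp.k p.2)) {p | 0 < p.1.im}

/-- `φ (h k(θ)) = φ(h) exp (i j θ)` with `j = m / 2`. -/
def IsKEigen (m : ℤ) (φ : Mp → V) : Prop :=
  ∀ (θ : ℝ) (h : Mp), φ (h * Mp.k θ) = Complex.exp (Complex.I * ((m : ℂ) / 2) * θ) • φ h

/-- The space `A(Mp₁(ℝ), ρ)`: linear combinations of smooth functions with a half-integral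
`K`-type that transform under `Γ` on the left according to `ρ`. -/
def autFunctions (Γ : Subgroup Mp) (ρ : Representation ℂ Γ V) : Submodule ℂ (Mp → V) :=
  Submodule.span ℂ {φ | IsSmoothMp φ ∧ ∃ m : ℤ, IsKEigen m φ} ⊓
    { carrier := {φ | ∀ (γ : Γ) (h : Mp), φ (γ * h) = ρ γ (φ h)}
      add_mem' := fun {a b} ha hb γ h ↦ by
        simp only [Pi.add_apply, map_add]; rw [ha γ h, hb γ h]
      zero_mem' := fun γ h ↦ by simp
      smul_mem' := fun c a ha γ h ↦ by
        simp only [Pi.smul_apply, map_smul]; rw [ha γ h] }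

/-- Admissibility: every `K`-isotypic component has finite dimension. -/
def GKSubmodule.IsAdmissible (W : GKSubmodule V) : Prop :=
  ∀ m : ℤ, FiniteDimensional ℂ (Submodule.span ℂ {φ | φ ∈ W.space ∧ IsKEigen m φ})

/-- A space of functions on the metaplectic group is a Harish-Chandra module inside
`A(Mp₁(ℝ), ρ)`: it is contained in that space and admissible. -/
def IsHarishChandraIn (Γ : Subgroup Mp) (ρ : Representation ℂ Γ V) (W : GKSubmodule V) : Prop :=
  W.space ≤ autFunctions Γ ρ ∧ W.IsAdmissible

end Forms

section Extensions

variable {V₁ V₂ V₃ : Type*} [NormedAddCommGroup V₁] [NormedSpace ℂ V₁]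
  [NormedAddCommGroup V₂] [NormedSpace ℂ V₂] [NormedAddCommGroup V₃] [NormedSpace ℂ V₃]

/-- `W₂` is a nonsplit extension `0 → W₁ → W₂ → W₃ → 0` of `(𝔤, K)`-modules: there is a short
exact sequence of homomorphisms of `(𝔤, K)`-modules that has no section. -/
def IsNonsplitExtension (W₁ : GKSubmodule V₁) (W₂ : GKSubmodule V₂) (W₃ : GKSubmodule V₃) : Prop :=
  ∃ (ι : W₁.space →ₗ[ℂ] W₂.space) (π : W₂.space →ₗ[ℂ] W₃.space),
    IsGKHom W₁ W₂ ι ∧ IsGKHom W₂ W₃ π ∧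
    Function.Injective ι ∧ Function.Exact ι π ∧ Function.Surjective π ∧
    ¬ ∃ s : W₃.space →ₗ[ℂ] W₂.space, IsGKHom W₃ W₂ s ∧ π ∘ₗ s = LinearMap.id

end Extensions

end Metaplectic

end

namespace Metaplectic

open LieAlgebra.SpecialLinear

noncomputable section

section

variable {V V' : Type*} [NormedAddCommGroup V] [NormedSpace ℂ V]
  [NormedAddCommGroup V'] [NormedSpace ℂ V']

/-! ### The compact subgroup -/

/-! Write k = κ/2 with κ odd. A real matrix in sl(2) is a combination of the rotation generator, a
raising element E⁺ and a lowering element E⁻. By `hasDerivAt_pullback`, E⁺ and E⁻ act on pullbacks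
as twice the raising operator R and twice the lowering operator L, and K acts on a pullback by a
character because it fixes i. So ϖ(f, k) is governed by the forms obtained from f by R and L.

The commutation relation `lowering_raising`, together with R_{k-2} L_k f = 0, shows that applying L
after R, or R after L, gives back a multiple of the original form. Suitably normalised, the iterates
form a chain F_j of weights k + 2j, one for each integer j, with explicit raising and lowering
coefficients (`isLadder_formLadder`). For j ≥ 0 these are the coefficients of the principal series
with ν = k - 1, and for j < 0 those with ν = 1 - k (`isLadder_phi`); the exception is the step from
0 down to -1, which has coefficient 1 instead of 0. As κ is odd, no coefficient leading away from f
vanishes.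

If f is holomorphic, F_{-1} = 2 L f is zero, only j ≥ 0 remains, and matching F_j with φ_j is an
isomorphism onto ϖ⁺(k - 1). If f is not holomorphic, all F_j are nonzero. Harmonicity says that E⁺
kills the function of F_{-1}, so the part j < 0 is a submodule isomorphic to ϖ⁻(1 - k), with
quotient ϖ⁺(k - 1). A section would lift the lowest weight vector of the quotient to a vector of
weight k killed by E⁻. The weight space is the line of F_0, on which E⁻ is injective, so there is no
section.

Both kinds of chain are instances of `IsLadder`. The representation theory is done once for ladders,
in `IsLadder.generated_space`, `IsLadder.isAdmissible`, `IsLadder.gkIsomorphic` and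
`IsLadder.isNonsplitExtension`. -/

theorem Mp.root_k_I (θ : ℝ) :
    (Mp.k θ).root UpperHalfPlane.I = Complex.exp (-Complex.I * θ / 2) := by
  have h0 : den (Mp.rotation θ) UpperHalfPlane.I ^ (1 / 2 : ℂ) ≠ 0 := by
    rw [Complex.cpow_ne_zero_iff]
    exact Or.inl (den_ne_zero _ _)
  simp only [Mp.k, Mp.ofValue]
  exact div_mul_cancel₀ _ h0

theorem Mp.root_k_I_zpow (θ : ℝ) (m : ℤ) :
    (Mp.k θ).root UpperHalfPlane.I ^ (-m) = Complex.exp (Complex.I * ((m : ℂ) / 2) * θ) := by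
  rw [Mp.root_k_I, ← Complex.exp_int_mul]
  congr 1
  push_cast
  ring

theorem Mp.k_mem_maxCompact (θ : ℝ) : Mp.k θ ∈ Mp.maxCompact := by
  change (Mp.rotation θ : Matrix (Fin 2) (Fin 2) ℝ)
    * (Mp.rotation θ : Matrix (Fin 2) (Fin 2) ℝ).transpose = 1
  have h := Real.sin_sq_add_cos_sq θ
  ext i j
  fin_cases i <;> fin_cases j <;>
    simp [Mp.rotation, Matrix.mul_apply, Fin.sum_univ_two] <;> nlinarith

/-- The characters of `K` are separated by their values at `k(1)`. -/
theorem exp_weight_injective :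
    Function.Injective fun m : ℤ ↦ Complex.exp (Complex.I * ((m : ℂ) / 2) * (1 : ℝ)) := by
  intro m n h
  obtain ⟨l, hl⟩ := Complex.exp_eq_exp_iff_exists_int.mp h
  -- Equal values force m - n = 4πl; irrationality of π leaves only l = 0.
  have h1 : ((m - n : ℤ) : ℝ) = (4 * l : ℤ) * Real.pi := by
    have h2 : ((m : ℂ) - n) = 4 * l * (Real.pi : ℂ) := by
      have := mul_left_cancel₀ Complex.I_ne_zero
        (show Complex.I * ((m : ℂ) - n) = Complex.I * (4 * l * (Real.pi : ℂ)) by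
          push_cast at hl
          linear_combination 2 * hl)
      exact this
    rw [← Complex.ofReal_inj]
    push_cast
    exact h2
  by_cases h4 : (4 * l : ℤ) = 0
  · rw [h4, Int.cast_zero, zero_mul, Int.cast_eq_zero] at h1
    exact sub_eq_zero.mp h1
  · exact absurd h1 ((irrational_pi.intCast_mul h4).ne_int _).symm

/-- Right translation as a linear map. -/
def translateLin (x : Mp) : (Mp → V) →ₗ[ℂ] (Mp → V) where
  toFun := translate x
  map_add' _ _ := rfl
  map_smul' _ _ := rfl

theorem translateLin_apply (x : Mp) (φ : Mp → V) : translateLin x φ = translate x φ := rfl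

/-! ### The Lie algebra -/

theorem lieAct_eq {Z : sl (Fin 2) ℂ} {φ ψ₁ ψ₂ : Mp → V}
    (h₁ : ∀ h, HasDerivAt (fun t : ℝ ↦ φ (h * Mp.lift (expSL (rePart Z) t))) (ψ₁ h) 0)
    (h₂ : ∀ h, HasDerivAt (fun t : ℝ ↦ φ (h * Mp.lift (expSL (imPart Z) t))) (ψ₂ h) 0) :
    lieAct Z φ = ψ₁ + Complex.I • ψ₂ := by
  funext h
  simp only [lieAct, rightDeriv, (h₁ h).deriv, (h₂ h).deriv, Pi.add_apply, Pi.smul_apply]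

/-- The coefficient of the weight in the action of a real matrix. -/
def rotCoeff (X : sl (Fin 2) ℝ) : ℂ := -Complex.I * ((X.1 1 0 - X.1 0 1 : ℝ) / 4)

/-- The coefficient of the raising operator in a real matrix. -/
def upCoeff (X : sl (Fin 2) ℝ) : ℂ :=
  ((X.1 0 0 : ℝ) - Complex.I * (X.1 1 0 + X.1 0 1 : ℝ) / 2) / 2

/-- The coefficient of the lowering operator in a real matrix. -/
def downCoeff (X : sl (Fin 2) ℝ) : ℂ :=
  ((X.1 0 0 : ℝ) + Complex.I * (X.1 1 0 + X.1 0 1 : ℝ) / 2) / 2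

/-- The raising element of `sl(2, ℂ)`. -/
def raisingElt : sl (Fin 2) ℂ :=
  ⟨!![1, Complex.I; Complex.I, -1], by
    change Matrix.trace (_ : Matrix (Fin 2) (Fin 2) ℂ) = 0
    simp [Matrix.trace_fin_two]⟩

/-- The lowering element of `sl(2, ℂ)`. -/
def loweringElt : sl (Fin 2) ℂ :=
  ⟨!![1, -Complex.I; -Complex.I, -1], by
    change Matrix.trace (_ : Matrix (Fin 2) (Fin 2) ℂ) = 0
    simp [Matrix.trace_fin_two]⟩

/-- The derivative in the direction of `X` of the `j`-th member of a sequence of functions of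
weights `κ + 4 j`, in which raising and lowering act with the coefficients `p` and `q`. -/
def ladderDeriv (κ : ℤ) (p q : ℤ → ℂ) (φ : ℤ → Mp → V) (j : ℤ) (X : sl (Fin 2) ℝ) : Mp → V :=
  (rotCoeff X * ((κ + 4 * j : ℤ) : ℂ)) • φ j + (p j * upCoeff X) • φ (j + 1)
    + (q j * downCoeff X) • φ (j - 1)

/-- Extended complex-linearly, `rotCoeff`, `upCoeff` and `downCoeff` take the values 0, 1, 0 on
`raisingElt` and 0, 0, 1 on `loweringElt`. -/
theorem ladderDeriv_raisingElt (κ : ℤ) (p q : ℤ → ℂ) (φ : ℤ → Mp → V) (j : ℤ) :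
    ladderDeriv κ p q φ j (rePart raisingElt)
      + Complex.I • ladderDeriv κ p q φ j (imPart raisingElt) = p j • φ (j + 1) := by
  simp only [ladderDeriv, rotCoeff, upCoeff, downCoeff, rePart, imPart, raisingElt]
  simp
  match_scalars <;> ring_nf <;> simp <;> ring

theorem ladderDeriv_loweringElt (κ : ℤ) (p q : ℤ → ℂ) (φ : ℤ → Mp → V) (j : ℤ) :
    ladderDeriv κ p q φ j (rePart loweringElt)
      + Complex.I • ladderDeriv κ p q φ j (imPart loweringElt) = q j • φ (j - 1) := by
  simp only [ladderDeriv, rotCoeff, upCoeff, downCoeff, rePart, imPart, loweringElt]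
  simp
  match_scalars <;> ring_nf <;> simp <;> ring

/-! ### Ladders -/

/-- A sequence of functions `φ j` of weights `κ + 4 j`, for `j` in `S`, on which the Lie algebra
acts by raising and lowering with the coefficients `p` and `q`. -/
structure IsLadder (κ : ℤ) (p q : ℤ → ℂ) (S : Set ℤ) (φ : ℤ → Mp → V) : Prop where
  hasDerivAt : ∀ j ∈ S, ∀ X h,
    HasDerivAt (fun t : ℝ ↦ φ j (h * Mp.lift (expSL X t))) (ladderDeriv κ p q φ j X h) 0
  translate_eq : ∀ j ∈ S, ∀ x ∈ Mp.maxCompact,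
    translate x (φ j) = (x.root UpperHalfPlane.I ^ (-(κ + 4 * j))) • φ j

/-- The set `S` is closed under the steps whose coefficient is nonzero. -/
def LadderClosed (p q : ℤ → ℂ) (S : Set ℤ) : Prop :=
  ∀ j ∈ S, (p j = 0 ∨ j + 1 ∈ S) ∧ (q j = 0 ∨ j - 1 ∈ S)

namespace IsLadder

variable {κ : ℤ} {p q : ℤ → ℂ} {S : Set ℤ} {φ : ℤ → Mp → V} {ψ : ℤ → Mp → V'}

theorem lieAct_raisingElt (hφ : IsLadder κ p q S φ) {j : ℤ} (hj : j ∈ S) :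
    lieAct raisingElt (φ j) = p j • φ (j + 1) := by
  rw [← ladderDeriv_raisingElt κ p q]
  exact lieAct_eq (hφ.hasDerivAt j hj _) (hφ.hasDerivAt j hj _)

theorem lieAct_loweringElt (hφ : IsLadder κ p q S φ) {j : ℤ} (hj : j ∈ S) :
    lieAct loweringElt (φ j) = q j • φ (j - 1) := by
  rw [← ladderDeriv_loweringElt κ p q]
  exact lieAct_eq (hφ.hasDerivAt j hj _) (hφ.hasDerivAt j hj _)

theorem mono (hφ : IsLadder κ p q S φ) {S' : Set ℤ} (h : S' ⊆ S) : IsLadder κ p q S' φ :=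
  ⟨fun j hj ↦ hφ.hasDerivAt j (h hj), fun j hj ↦ hφ.translate_eq j (h hj)⟩

/-- The ladder relations only involve the products of the coefficients with the functions, and
they hold at an index where the function and these products vanish. -/
theorem congr (hφ : IsLadder κ p q S φ) {p' q' : ℤ → ℂ} {T : Set ℤ} {φ' : ℤ → Mp → V}
    (h : ∀ j ∈ T, (j ∈ S ∧ φ' j = φ j ∧ p' j • φ' (j + 1) = p j • φ (j + 1) ∧
        q' j • φ' (j - 1) = q j • φ (j - 1)) ∨
      (φ' j = 0 ∧ p' j • φ' (j + 1) = 0 ∧ q' j • φ' (j - 1) = 0)) : IsLadder κ p' q' T φ' where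
  hasDerivAt j hj X g := by
    have e : ladderDeriv κ p' q' φ' j X = (rotCoeff X * ((κ + 4 * j : ℤ) : ℂ)) • φ' j
        + upCoeff X • (p' j • φ' (j + 1)) + downCoeff X • (q' j • φ' (j - 1)) := by
      rw [ladderDeriv, mul_comm (p' j), mul_comm (q' j), mul_smul (upCoeff X),
        mul_smul (downCoeff X)]
    rw [e]
    rcases h j hj with ⟨hS, h0, hp, hq⟩ | ⟨h0, hp, hq⟩
    · have e' := hφ.hasDerivAt j hS X g
      rwa [ladderDeriv, mul_comm (p j), mul_comm (q j), mul_smul (upCoeff X),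
        mul_smul (downCoeff X), ← hp, ← hq, ← h0] at e'
    · rw [h0, hp, hq]
      simp only [smul_zero, add_zero]
      exact hasDerivAt_const _ _
  translate_eq j hj x hx := by
    rcases h j hj with ⟨hS, h0, -, -⟩ | ⟨h0, -, -⟩
    · rw [h0]
      exact hφ.translate_eq j hS x hx
    · rw [h0, smul_zero]
      rfl

theorem ladderDeriv_mem (hS : LadderClosed p q S) {M : Submodule ℂ (Mp → V)}
    (hM : ∀ j ∈ S, φ j ∈ M) {j : ℤ} (hj : j ∈ S) (X : sl (Fin 2) ℝ) :
    ladderDeriv κ p q φ j X ∈ M := by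
  obtain ⟨h1, h2⟩ := hS j hj
  refine M.add_mem (M.add_mem (M.smul_mem _ (hM j hj)) ?_) ?_
  · rcases h1 with h1 | h1
    · simp [h1]
    · exact M.smul_mem _ (hM _ h1)
  · rcases h2 with h2 | h2
    · simp [h2]
    · exact M.smul_mem _ (hM _ h2)

/-- The members are eigenvectors of translation by the single element k(1), with distinct
eigenvalues by `exp_weight_injective`. -/
theorem linearIndependent (hφ : IsLadder κ p q S φ) (hne : ∀ j ∈ S, φ j ≠ 0) :
    LinearIndependent ℂ (fun j : S ↦ φ j) := by
  refine Module.End.eigenvectors_linearIndependent' (translateLin (Mp.k 1))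
    (fun j : S ↦ Complex.exp (Complex.I * (((κ + 4 * j : ℤ) : ℂ) / 2) * (1 : ℝ))) ?_ _ ?_
  · intro i j h
    have := exp_weight_injective h
    exact Subtype.ext (by lia)
  · intro j
    refine Module.End.hasEigenvector_iff.mpr ⟨?_, hne j j.2⟩
    rw [Module.End.mem_eigenspace_iff, translateLin_apply,
      hφ.translate_eq j j.2 _ (Mp.k_mem_maxCompact 1), Mp.root_k_I_zpow]

/-- Elements of the span of a ladder are differentiable, with derivatives in the span. -/
theorem exists_deriv (hφ : IsLadder κ p q S φ) (hS : LadderClosed p q S) (X : sl (Fin 2) ℝ)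
    {w : Mp → V} (hw : w ∈ Submodule.span ℂ (φ '' S)) :
    ∃ u ∈ Submodule.span ℂ (φ '' S),
      ∀ h, HasDerivAt (fun t : ℝ ↦ w (h * Mp.lift (expSL X t))) (u h) 0 := by
  induction hw using Submodule.span_induction with
  | mem w h =>
    obtain ⟨j, hj, rfl⟩ := h
    exact ⟨_, ladderDeriv_mem (κ := κ) hS
      (fun j hj ↦ Submodule.subset_span (Set.mem_image_of_mem φ hj)) hj X, hφ.hasDerivAt j hj X⟩
  | zero => exact ⟨0, Submodule.zero_mem _, fun h ↦ hasDerivAt_const _ _⟩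
  | add w₁ w₂ _ _ h₁ h₂ =>
    obtain ⟨u₁, m₁, d₁⟩ := h₁
    obtain ⟨u₂, m₂, d₂⟩ := h₂
    exact ⟨_, Submodule.add_mem _ m₁ m₂, fun h ↦ (d₁ h).add (d₂ h)⟩
  | smul c w₁ _ h₁ =>
    obtain ⟨u₁, m₁, d₁⟩ := h₁
    exact ⟨_, Submodule.smul_mem _ c m₁, fun h ↦ (d₁ h).const_smul c⟩

theorem lieAct_mem (hφ : IsLadder κ p q S φ) (hS : LadderClosed p q S) (Z : sl (Fin 2) ℂ)
    {w : Mp → V} (hw : w ∈ Submodule.span ℂ (φ '' S)) :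
    lieAct Z w ∈ Submodule.span ℂ (φ '' S) := by
  obtain ⟨u₁, m₁, d₁⟩ := hφ.exists_deriv hS (rePart Z) hw
  obtain ⟨u₂, m₂, d₂⟩ := hφ.exists_deriv hS (imPart Z) hw
  rw [lieAct_eq d₁ d₂]
  exact Submodule.add_mem _ m₁ (Submodule.smul_mem _ _ m₂)

theorem translate_mem (hφ : IsLadder κ p q S φ) {x : Mp} (hx : x ∈ Mp.maxCompact)
    {w : Mp → V} (hw : w ∈ Submodule.span ℂ (φ '' S)) :
    translate x w ∈ Submodule.span ℂ (φ '' S) := by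
  have : Submodule.span ℂ (φ '' S) ≤
      (Submodule.span ℂ (φ '' S)).comap (translateLin (V := V) x) := by
    rw [Submodule.span_le]
    rintro _ ⟨j, hj, rfl⟩
    change translate x (φ j) ∈ Submodule.span ℂ (φ '' S)
    rw [hφ.translate_eq j hj x hx]
    exact Submodule.smul_mem _ _ (Submodule.subset_span ⟨j, hj, rfl⟩)
  exact this hw

end IsLadder

/-! ### Maps between modules that are spanned by ladders -/

section Maps

variable {S : Set ℤ} {φ : ℤ → Mp → V} {ψ : ℤ → Mp → V'}

theorem mem_of_space_eq {W : GKSubmodule V} (hW : W.space = Submodule.span ℂ (φ '' S)) {j : ℤ}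
    (hj : j ∈ S) : φ j ∈ W.space := by
  rw [hW]
  exact Submodule.subset_span ⟨j, hj, rfl⟩

theorem exists_linearMap {W : GKSubmodule V} {W' : GKSubmodule V'}
    (hW : W.space = Submodule.span ℂ (φ '' S)) (hli : LinearIndependent ℂ (fun j : S ↦ φ j))
    (hψ : ∀ j ∈ S, ψ j ∈ W'.space) :
    ∃ T : W.space →ₗ[ℂ] W'.space, ∀ j (hj : j ∈ S),
      T ⟨φ j, mem_of_space_eq hW hj⟩ = ⟨ψ j, hψ j hj⟩ := by
  have hr : Submodule.span ℂ (φ '' S) = Submodule.span ℂ (Set.range fun j : S ↦ φ j) := by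
    rw [Set.image_eq_range]
  let e := LinearEquiv.ofEq _ _ (hW.trans hr)
  let T : W.space →ₗ[ℂ] W'.space :=
    (Module.Basis.span hli).constr ℂ (fun j : S ↦ (⟨ψ j, hψ j j.2⟩ : W'.space)) ∘ₗ e.toLinearMap
  refine ⟨T, fun j hj ↦ ?_⟩
  have : e ⟨φ j, mem_of_space_eq hW hj⟩ = Module.Basis.span hli ⟨j, hj⟩ := by
    ext1
    rw [Module.Basis.span_apply]
    rfl
  simp only [T, LinearMap.comp_apply, LinearEquiv.coe_coe, this, Module.Basis.constr_basis]

theorem linearMap_ext {W : GKSubmodule V} {M : Type*} [AddCommGroup M] [Module ℂ M]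
    (hW : W.space = Submodule.span ℂ (φ '' S)) {T T' : W.space →ₗ[ℂ] M}
    (h : ∀ j (hj : j ∈ S), T ⟨φ j, mem_of_space_eq hW hj⟩ = T' ⟨φ j, mem_of_space_eq hW hj⟩) :
    T = T' := by
  ext ⟨w, hw⟩
  have hw' := hw
  rw [hW] at hw'
  induction hw' using Submodule.span_induction with
  | mem w h' =>
    obtain ⟨j, hj, rfl⟩ := h'
    exact h j hj
  | zero => exact (T.map_zero).trans (T'.map_zero).symm
  | add w₁ w₂ h₁ h₂ e₁ e₂ =>
    rw [← hW] at h₁ h₂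
    exact (T.map_add ⟨w₁, h₁⟩ ⟨w₂, h₂⟩).trans ((congrArg₂ (· + ·) (e₁ h₁) (e₂ h₂)).trans
      (T'.map_add ⟨w₁, h₁⟩ ⟨w₂, h₂⟩).symm)
  | smul c w₁ h₁ e₁ =>
    rw [← hW] at h₁
    exact (T.map_smul c ⟨w₁, h₁⟩).trans ((congrArg (c • ·) (e₁ h₁)).trans
      (T'.map_smul c ⟨w₁, h₁⟩).symm)

/-- The two ladders share their weights and coefficients, so matching members intertwines the
actions. The functions ψ j may vanish, which allows maps with a kernel, such as the projection onto
a quotient. -/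
theorem IsLadder.isGKHom {κ : ℤ} {p q : ℤ → ℂ} {W : GKSubmodule V} {W' : GKSubmodule V'}
    (hW : W.space = Submodule.span ℂ (φ '' S)) (hφ : IsLadder κ p q S φ)
    (hψ : IsLadder κ p q S ψ) (hS : LadderClosed p q S) (T : W.space →ₗ[ℂ] W'.space)
    (hT : ∀ j (hj : j ∈ S), (T ⟨φ j, mem_of_space_eq hW hj⟩ : Mp → V') = ψ j) :
    IsGKHom W W' T := by
  -- `lieAct` is defined through `deriv`, which is additive only on differentiable functions. The
  -- induction therefore carries differentiability of w and of its image along with the values of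
  -- the derivatives.
  have key : ∀ (X : sl (Fin 2) ℝ) (w : Mp → V) (hw : w ∈ W.space), ∃ u : W.space,
      (∀ h, HasDerivAt (fun t : ℝ ↦ w (h * Mp.lift (expSL X t))) ((u : Mp → V) h) 0) ∧
      ∀ h, HasDerivAt (fun t : ℝ ↦ (T ⟨w, hw⟩ : Mp → V') (h * Mp.lift (expSL X t)))
        ((T u : Mp → V') h) 0 := by
    intro X w hw
    have hw' := hw
    rw [hW] at hw'
    induction hw' using Submodule.span_induction with
    | mem w h' =>
      obtain ⟨j, hj, rfl⟩ := h'
      have hm : ladderDeriv κ p q φ j X ∈ W.space :=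
        ladderDeriv_mem hS (fun j hj ↦ mem_of_space_eq hW hj) hj X
      refine ⟨⟨_, hm⟩, hφ.hasDerivAt j hj X, fun h ↦ ?_⟩
      have e : (T ⟨_, hm⟩ : Mp → V') = ladderDeriv κ p q ψ j X := by
        obtain ⟨h1, h2⟩ := hS j hj
        -- When the step leaves S, the neighbour need not lie in W, but its coefficient vanishes and
        -- the zero vector serves.
        have a1 : ∃ u : W.space, (u : Mp → V) = (p j * upCoeff X) • φ (j + 1) ∧
            (T u : Mp → V') = (p j * upCoeff X) • ψ (j + 1) := by
          rcases h1 with h1 | h1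
          · exact ⟨0, by simp [h1], by simp [h1]⟩
          · exact ⟨(p j * upCoeff X) • ⟨_, mem_of_space_eq hW h1⟩, rfl, by
              rw [map_smul, Submodule.coe_smul, hT _ h1]⟩
        have a2 : ∃ u : W.space, (u : Mp → V) = (q j * downCoeff X) • φ (j - 1) ∧
            (T u : Mp → V') = (q j * downCoeff X) • ψ (j - 1) := by
          rcases h2 with h2 | h2
          · exact ⟨0, by simp [h2], by simp [h2]⟩
          · exact ⟨(q j * downCoeff X) • ⟨_, mem_of_space_eq hW h2⟩, rfl, by
              rw [map_smul, Submodule.coe_smul, hT _ h2]⟩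
        obtain ⟨u₁, v₁, t₁⟩ := a1
        obtain ⟨u₂, v₂, t₂⟩ := a2
        have : (⟨_, hm⟩ : W.space) = (rotCoeff X * ((κ + 4 * j : ℤ) : ℂ)) •
            (⟨φ j, mem_of_space_eq hW hj⟩ : W.space) + u₁ + u₂ := by
          ext1
          simp only [Submodule.coe_add, Submodule.coe_smul, v₁, v₂, ladderDeriv]
        rw [this, map_add, map_add, map_smul, Submodule.coe_add, Submodule.coe_add,
          Submodule.coe_smul, t₁, t₂, hT j hj, ladderDeriv]
      rw [e]
      simp only [hT j hj]
      exact hψ.hasDerivAt j hj X h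
    | zero =>
      refine ⟨0, fun h ↦ hasDerivAt_const _ _, ?_⟩
      have : T ⟨0, hw⟩ = 0 := T.map_zero
      rw [this, map_zero]
      exact fun h ↦ hasDerivAt_const _ _
    | add w₁ w₂ m₁ m₂ h₁ h₂ =>
      rw [← hW] at m₁ m₂
      obtain ⟨u₁, d₁, e₁⟩ := h₁ m₁
      obtain ⟨u₂, d₂, e₂⟩ := h₂ m₂
      have : T ⟨w₁ + w₂, hw⟩ = T ⟨w₁, m₁⟩ + T ⟨w₂, m₂⟩ := T.map_add ⟨w₁, m₁⟩ ⟨w₂, m₂⟩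
      rw [this]
      refine ⟨u₁ + u₂, fun h ↦ (d₁ h).add (d₂ h), ?_⟩
      rw [map_add]
      exact fun h ↦ (e₁ h).add (e₂ h)
    | smul c w₁ m₁ h₁ =>
      rw [← hW] at m₁
      obtain ⟨u₁, d₁, e₁⟩ := h₁ m₁
      have : T ⟨c • w₁, hw⟩ = c • T ⟨w₁, m₁⟩ := T.map_smul c ⟨w₁, m₁⟩
      rw [this]
      refine ⟨c • u₁, fun h ↦ (d₁ h).const_smul c, ?_⟩
      rw [map_smul]
      exact fun h ↦ (e₁ h).const_smul c
  constructor
  · rintro Z ⟨w, hw⟩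
    obtain ⟨u₁, d₁, e₁⟩ := key (rePart Z) w hw
    obtain ⟨u₂, d₂, e₂⟩ := key (imPart Z) w hw
    rw [lieAct_eq e₁ e₂]
    have : (⟨lieAct Z w, W.lie_mem Z w hw⟩ : W.space) = u₁ + Complex.I • u₂ :=
      Subtype.ext (lieAct_eq d₁ d₂)
    change (T ⟨lieAct Z w, W.lie_mem Z w hw⟩ : Mp → V') = _
    rw [this, map_add, map_smul]
    rfl
  · intro x hx w
    let R : W.space →ₗ[ℂ] W.space :=
      (translateLin x).restrict (fun φ hφ ↦ W.translate_mem x hx φ hφ)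
    have : W'.space.subtype ∘ₗ T ∘ₗ R = translateLin x ∘ₗ W'.space.subtype ∘ₗ T := by
      refine linearMap_ext hW fun j hj ↦ ?_
      have e : R ⟨φ j, mem_of_space_eq hW hj⟩ = (x.root UpperHalfPlane.I ^ (-(κ + 4 * j))) •
          (⟨φ j, mem_of_space_eq hW hj⟩ : W.space) :=
        Subtype.ext (hφ.translate_eq j hj x hx)
      simp only [LinearMap.comp_apply, e, map_smul, Submodule.subtype_apply, hT j hj,
        translateLin_apply, hψ.translate_eq j hj x hx]
    exact LinearMap.congr_fun this w

end Maps

/-! ### Isotypic components of a ladder. -/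

/-- A vector of weight `m` in the span of a ladder is a multiple of the member of weight `m`. -/
theorem IsLadder.mem_span_of_isKEigen {κ : ℤ} {p q : ℤ → ℂ} {S : Set ℤ} {φ : ℤ → Mp → V}
    (hφ : IsLadder κ p q S φ) (hne : ∀ j ∈ S, φ j ≠ 0) {w : Mp → V}
    (hw : w ∈ Submodule.span ℂ (φ '' S)) {m : ℤ} (hm : IsKEigen m w) :
    w ∈ Submodule.span ℂ (φ '' {j | κ + 4 * j = m}) := by
  have hli := hφ.linearIndependent hne
  rw [Set.image_eq_range, Finsupp.mem_span_range_iff_exists_finsupp] at hw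
  obtain ⟨c, rfl⟩ := hw
  -- Translation by k(1) minus the eigenvalue of weight m kills w. By linear independence each
  -- coefficient times the difference of eigenvalues is zero, so only weight m survives.
  have e1 := funext (hm 1)
  change translateLin (Mp.k 1) (c.sum fun i a ↦ a • φ i) = Complex.exp (Complex.I * ((m : ℂ) / 2) *
    (1 : ℝ)) • (c.sum fun i a ↦ a • φ i) at e1
  rw [Finsupp.sum, map_sum, Finset.smul_sum, ← sub_eq_zero, ← Finset.sum_sub_distrib] at e1
  have e2 : ∀ i : S, translateLin (Mp.k 1) (c i • φ i) - Complex.exp (Complex.I * ((m : ℂ) / 2) *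
      (1 : ℝ)) • c i • φ i = ((Complex.exp (Complex.I * (((κ + 4 * i : ℤ) : ℂ) / 2) * (1 : ℝ)) -
        Complex.exp (Complex.I * ((m : ℂ) / 2) * (1 : ℝ))) * c i) • φ i := by
    intro i
    rw [map_smul, translateLin_apply, hφ.translate_eq i i.2 _ (Mp.k_mem_maxCompact 1),
      Mp.root_k_I_zpow]
    module
  simp only [e2] at e1
  have e3 := linearIndependent_iff'.mp hli _ _ e1
  refine Submodule.sum_mem _ fun i hi ↦ Submodule.smul_mem _ _ (Submodule.subset_span ⟨i, ?_, rfl⟩)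
  have e4 := (mul_eq_zero.mp (e3 i hi)).resolve_right (Finsupp.mem_support_iff.mp hi)
  exact exp_weight_injective (sub_eq_zero.mp e4)

/-- Weights along a ladder are distinct, so every isotypic component has dimension at most one. -/
theorem IsLadder.isAdmissible {κ : ℤ} {p q : ℤ → ℂ} {S : Set ℤ} {φ : ℤ → Mp → V}
    {W : GKSubmodule V} (hW : W.space = Submodule.span ℂ (φ '' S)) (hφ : IsLadder κ p q S φ)
    (hne : ∀ j ∈ S, φ j ≠ 0) : W.IsAdmissible := by
  intro m
  have hfin : (φ '' {j | κ + 4 * j = m}).Finite :=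
    Set.Subsingleton.finite (Set.Subsingleton.image (fun i hi j hj ↦ by
      simp only [Set.mem_ofPred_eq] at hi hj; lia) _)
  have : FiniteDimensional ℂ (Submodule.span ℂ (φ '' {j | κ + 4 * j = m})) :=
    FiniteDimensional.span_of_finite ℂ hfin
  refine Submodule.finiteDimensional_of_le (S₂ := Submodule.span ℂ (φ '' {j | κ + 4 * j = m})) ?_
  rw [Submodule.span_le]
  rintro w ⟨hw, hm⟩
  rw [hW] at hw
  exact hφ.mem_span_of_isKEigen hne hw hm

end

/-! ### Modules spanned by ladders: generation, isomorphism and extension. -/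

section

variable {V V' V'' : Type*} [NormedAddCommGroup V] [NormedSpace ℂ V]
  [NormedAddCommGroup V'] [NormedSpace ℂ V'] [NormedAddCommGroup V''] [NormedSpace ℂ V'']

/-- The span is stable, hence contains the generated module. Conversely, each member is reached from
index 0 by raising or lowering, dividing by a nonzero coefficient at every step. -/
theorem IsLadder.generated_space {κ : ℤ} {p q : ℤ → ℂ} {S : Set ℤ} {φ : ℤ → Mp → V}
    (hφ : IsLadder κ p q S φ) (hS : LadderClosed p q S) (h0 : (0 : ℤ) ∈ S)
    (hp : ∀ j ∈ S, 0 < j → j - 1 ∈ S ∧ p (j - 1) ≠ 0)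
    (hq : ∀ j ∈ S, j < 0 → j + 1 ∈ S ∧ q (j + 1) ≠ 0) :
    (generated (φ 0)).space = Submodule.span ℂ (φ '' S) := by
  refine le_antisymm (sInf_le ⟨Submodule.subset_span ⟨0, h0, rfl⟩,
    fun Z w hw ↦ hφ.lieAct_mem hS Z hw, fun x hx w hw ↦ hφ.translate_mem hx hw⟩) ?_
  refine le_sInf fun W ⟨hW, hlie, _⟩ ↦ ?_
  rw [Submodule.span_le]
  have hup : ∀ n : ℕ, (n : ℤ) ∈ S → φ n ∈ W := by
    intro n
    induction n with
    | zero => exact fun _ ↦ hW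
    | succ n ih =>
      intro hn
      obtain ⟨h1, h2⟩ := hp _ hn (by lia)
      rw [show ((n + 1 : ℕ) : ℤ) - 1 = n by push_cast; ring] at h1 h2
      have h3 := hlie raisingElt _ (ih h1)
      rw [hφ.lieAct_raisingElt h1] at h3
      simpa [smul_smul, h2] using W.smul_mem (p n)⁻¹ h3
  have hdown : ∀ n : ℕ, (-n : ℤ) ∈ S → φ (-n) ∈ W := by
    intro n
    induction n with
    | zero => exact fun _ ↦ by simpa using hW
    | succ n ih =>
      intro hn
      obtain ⟨h1, h2⟩ := hq _ hn (by lia)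
      rw [show -((n + 1 : ℕ) : ℤ) + 1 = -n by push_cast; ring] at h1 h2
      have h3 := hlie loweringElt _ (ih h1)
      rw [hφ.lieAct_loweringElt h1, show -(n : ℤ) - 1 = -((n + 1 : ℕ) : ℤ) by push_cast; ring] at h3
      simpa [smul_smul, h2] using W.smul_mem (q (-n))⁻¹ h3
  rintro _ ⟨j, hj, rfl⟩
  rcases le_total 0 j with h | h
  · lift j to ℕ using h
    exact hup j hj
  · obtain ⟨n, rfl⟩ := Int.exists_eq_neg_ofNat h
    exact hdown n hj

theorem IsLadder.gkIsomorphic {κ : ℤ} {p q : ℤ → ℂ} {S : Set ℤ} {φ : ℤ → Mp → V}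
    {ψ : ℤ → Mp → V'} {W : GKSubmodule V} {W' : GKSubmodule V'}
    (hW : W.space = Submodule.span ℂ (φ '' S)) (hW' : W'.space = Submodule.span ℂ (ψ '' S))
    (hφ : IsLadder κ p q S φ) (hψ : IsLadder κ p q S ψ) (hS : LadderClosed p q S)
    (hφ0 : ∀ j ∈ S, φ j ≠ 0) (hψ0 : ∀ j ∈ S, ψ j ≠ 0) : GKIsomorphic W W' := by
  obtain ⟨T, hT⟩ := exists_linearMap hW (hφ.linearIndependent hφ0)
    (fun j hj ↦ mem_of_space_eq hW' hj)
  obtain ⟨T', hT'⟩ := exists_linearMap hW' (hψ.linearIndependent hψ0)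
    (fun j hj ↦ mem_of_space_eq hW hj)
  refine ⟨LinearEquiv.ofLinearMap T T' (linearMap_ext hW' fun j hj ↦ ?_)
    (linearMap_ext hW fun j hj ↦ ?_), IsLadder.isGKHom hW hφ hψ hS _ fun j hj ↦ ?_⟩
  · simp only [LinearMap.comp_apply, hT' j hj, hT j hj, LinearMap.id_apply]
  · simp only [LinearMap.comp_apply, hT' j hj, hT j hj, LinearMap.id_apply]
  · exact congrArg Subtype.val (hT j hj)

/-- A ladder that can be lowered from index `0` to index `-1`, but not raised back, generates a
nonsplit extension. -/
theorem IsLadder.isNonsplitExtension {κ : ℤ} {p q p₁ q₁ p₃ q₃ : ℤ → ℂ} {φ : ℤ → Mp → V}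
    {ψ₁ : ℤ → Mp → V'} {ψ₃ : ℤ → Mp → V''} {W : GKSubmodule V} {W₁ : GKSubmodule V'}
    {W₃ : GKSubmodule V''} (hW : W.space = Submodule.span ℂ (φ '' Set.univ))
    (hW₁ : W₁.space = Submodule.span ℂ (ψ₁ '' Set.Iio 0))
    (hW₃ : W₃.space = Submodule.span ℂ (ψ₃ '' Set.Ici 0))
    (hφ : IsLadder κ p q Set.univ φ) (hψ₁ : IsLadder κ p₁ q₁ (Set.Iio 0) ψ₁)
    (hψ₃ : IsLadder κ p₃ q₃ (Set.Ici 0) ψ₃)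
    (hφ0 : ∀ j, φ j ≠ 0) (hψ₁0 : ∀ j < 0, ψ₁ j ≠ 0) (hψ₃0 : ∀ j, 0 ≤ j → ψ₃ j ≠ 0)
    (hp₁ : ∀ j < 0, p j = p₁ j) (hq₁ : ∀ j < 0, q j = q₁ j)
    (hp₃ : ∀ j, 0 ≤ j → p j = p₃ j) (hq₃ : ∀ j, 0 < j → q j = q₃ j)
    (hp : p (-1) = 0) (hq : q 0 ≠ 0) (hq₃0 : q₃ 0 = 0) : IsNonsplitExtension W₁ W W₃ := by
  classical
  have hliφ := hφ.linearIndependent fun j _ ↦ hφ0 j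
  have hcl : LadderClosed p q Set.univ := fun j _ ↦ ⟨Or.inr trivial, Or.inr trivial⟩
  -- The negative indices give a submodule because the only step out of them, from -1 up to 0, has
  -- coefficient zero.
  have hcl₁ : LadderClosed p q (Set.Iio 0) := fun j hj ↦ by
    rw [Set.mem_Iio] at hj
    refine ⟨?_, Or.inr (Set.mem_Iio.mpr (by lia))⟩
    rcases eq_or_ne j (-1) with rfl | h
    · exact Or.inl hp
    · exact Or.inr (Set.mem_Iio.mpr (by lia))
  have hψ₁' : IsLadder κ p q (Set.Iio 0) ψ₁ := hψ₁.congr fun j hj ↦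
    Or.inl ⟨hj, rfl, by rw [hp₁ j hj], by rw [hq₁ j hj]⟩
  -- Extensions by zero to all indices: the images of the φ j under the linear retraction onto W₁
  -- and under the projection to W₃.
  set ψ₁t : ℤ → Mp → V' := fun j ↦ if j < 0 then ψ₁ j else 0
  set ψ₃t : ℤ → Mp → V'' := fun j ↦ if j < 0 then 0 else ψ₃ j
  -- Two boundary steps matter. From -1 to 0 the coefficient p (-1) is zero; from 0 to -1 the
  -- coefficients q 0 and q₃ 0 differ, but the extended function at -1 is zero.
  have hψ₃t : IsLadder κ p q Set.univ ψ₃t := hψ₃.congr fun j _ ↦ by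
    rcases lt_or_ge j 0 with h | h
    · right
      refine ⟨if_pos h, ?_, ?_⟩
      · rcases eq_or_ne j (-1) with rfl | h'
        · rw [hp, zero_smul]
        · rw [show ψ₃t (j + 1) = 0 from if_pos (by lia), smul_zero]
      · rw [show ψ₃t (j - 1) = 0 from if_pos (by lia), smul_zero]
    · left
      refine ⟨h, if_neg h.not_gt, ?_, ?_⟩
      · rw [hp₃ j h, show ψ₃t (j + 1) = ψ₃ (j + 1) from if_neg (by lia)]
      · rcases eq_or_ne j 0 with rfl | h'
        · rw [hq₃0, zero_smul, show ψ₃t (0 - 1) = 0 from if_pos (by lia), smul_zero]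
        · rw [hq₃ j (by lia), show ψ₃t (j - 1) = ψ₃ (j - 1) from if_neg (by lia)]
  have m₁ : ∀ j, ψ₁t j ∈ W₁.space := fun j ↦ by
    rcases lt_or_ge j 0 with h | h
    · rw [show ψ₁t j = ψ₁ j from if_pos h]
      exact mem_of_space_eq hW₁ h
    · rw [show ψ₁t j = 0 from if_neg h.not_gt]
      exact W₁.space.zero_mem
  have m₃ : ∀ j, ψ₃t j ∈ W₃.space := fun j ↦ by
    rcases lt_or_ge j 0 with h | h
    · rw [show ψ₃t j = 0 from if_pos h]
      exact W₃.space.zero_mem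
    · rw [show ψ₃t j = ψ₃ j from if_neg h.not_gt]
      exact mem_of_space_eq hW₃ h
  obtain ⟨ι, hι⟩ := exists_linearMap (ψ := φ) (W' := W) hW₁ (hψ₁.linearIndependent hψ₁0)
    (fun j _ ↦ mem_of_space_eq hW trivial)
  obtain ⟨π, hπ⟩ := exists_linearMap (W' := W₃) hW hliφ (fun j _ ↦ m₃ j)
  -- The maps r and s split the sequence as vector spaces only. The identities they satisfy yield
  -- injectivity, exactness and surjectivity formally.
  obtain ⟨r, hr⟩ := exists_linearMap (W' := W₁) hW hliφ (fun j _ ↦ m₁ j)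
  obtain ⟨s, hs⟩ := exists_linearMap (ψ := φ) (W' := W) hW₃ (hψ₃.linearIndependent hψ₃0)
    (fun j _ ↦ mem_of_space_eq hW trivial)
  have hrι : r ∘ₗ ι = LinearMap.id := linearMap_ext hW₁ fun j hj ↦ by
    rw [LinearMap.comp_apply, hι j hj, hr j trivial]
    exact Subtype.ext (if_pos hj)
  have hπs : π ∘ₗ s = LinearMap.id := linearMap_ext hW₃ fun j hj ↦ by
    rw [LinearMap.comp_apply, hs j hj, hπ j trivial]
    exact Subtype.ext (if_neg (not_lt.mpr hj))
  have hπι : π ∘ₗ ι = 0 := linearMap_ext hW₁ fun j hj ↦ by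
    rw [LinearMap.comp_apply, hι j hj, hπ j trivial]
    exact Subtype.ext (if_pos hj)
  have hsum : ι ∘ₗ r + s ∘ₗ π = LinearMap.id := linearMap_ext hW fun j _ ↦ by
    rw [LinearMap.add_apply, LinearMap.comp_apply, LinearMap.comp_apply, hr j trivial,
      hπ j trivial, LinearMap.id_apply]
    rcases lt_or_ge j 0 with h | h
    · have e₁ : (⟨ψ₁t j, m₁ j⟩ : W₁.space) = ⟨ψ₁ j, mem_of_space_eq hW₁ h⟩ :=
        Subtype.ext (if_pos h)
      have e₃ : (⟨ψ₃t j, m₃ j⟩ : W₃.space) = 0 := Subtype.ext (if_pos h)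
      rw [e₁, e₃, hι j h, map_zero, add_zero]
    · have e₁ : (⟨ψ₁t j, m₁ j⟩ : W₁.space) = 0 := Subtype.ext (if_neg h.not_gt)
      have e₃ : (⟨ψ₃t j, m₃ j⟩ : W₃.space) = ⟨ψ₃ j, mem_of_space_eq hW₃ h⟩ :=
        Subtype.ext (if_neg h.not_gt)
      rw [e₁, e₃, hs j h, map_zero, zero_add]
  have hdecomp : ∀ w, ι (r w) + s (π w) = w := LinearMap.congr_fun hsum
  refine ⟨ι, π, IsLadder.isGKHom hW₁ hψ₁' (hφ.mono (Set.subset_univ _)) hcl₁ _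
    (fun j hj ↦ congrArg Subtype.val (hι j hj)), IsLadder.isGKHom hW hφ hψ₃t hcl _
    (fun j hj ↦ congrArg Subtype.val (hπ j hj)),
    Function.LeftInverse.injective (LinearMap.congr_fun hrι), fun w ↦ ⟨fun h ↦ ⟨r w, ?_⟩, ?_⟩,
    Function.RightInverse.surjective (LinearMap.congr_fun hπs), ?_⟩
  · have := hdecomp w
    rwa [h, map_zero, add_zero] at this
  · rintro ⟨w, rfl⟩
    exact LinearMap.congr_fun hπι w
  · rintro ⟨s', hs', hπs'⟩
    have h0 : (0 : ℤ) ∈ Set.Ici (0 : ℤ) := Set.mem_Ici.mpr le_rfl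
    set v : W₃.space := ⟨ψ₃ 0, mem_of_space_eq hW₃ h0⟩
    -- The lowest weight vector v is killed by lowering and has weight κ; an equivariant section
    -- preserves both properties, which no nonzero vector of W has.
    have hkill : lieAct loweringElt (s' v : Mp → V) = 0 := by
      rw [← hs'.map_lie]
      have : (⟨lieAct loweringElt v, W₃.lie_mem _ _ v.2⟩ : W₃.space) = 0 :=
        Subtype.ext (by
          change lieAct loweringElt (ψ₃ 0) = 0
          rw [hψ₃.lieAct_loweringElt h0, hq₃0, zero_smul])
      rw [this, map_zero]
      rfl
    have heig : IsKEigen κ (s' v : Mp → V) := by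
      intro θ
      have e1 : (⟨translate (Mp.k θ) v, W₃.translate_mem _ (Mp.k_mem_maxCompact θ) _ v.2⟩ :
          W₃.space) = Complex.exp (Complex.I * ((κ : ℂ) / 2) * θ) • v := Subtype.ext (by
        change translate (Mp.k θ) (ψ₃ 0) = _
        rw [hψ₃.translate_eq 0 h0 _ (Mp.k_mem_maxCompact θ), mul_zero, add_zero,
          Mp.root_k_I_zpow]
        rfl)
      have e2 := hs'.map_translate (Mp.k θ) (Mp.k_mem_maxCompact θ) v
      rw [e1, map_smul] at e2
      exact fun h ↦ (congrFun e2 h).symm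
    have hmem := hφ.mem_span_of_isKEigen (fun j _ ↦ hφ0 j) (hW ▸ (s' v).2) heig
    have hset : {j : ℤ | κ + 4 * j = κ} = {0} := by
      ext j
      simp
    rw [hset, Set.image_singleton, Submodule.mem_span_singleton] at hmem
    obtain ⟨c, hc⟩ := hmem
    -- Now s' v is c times φ 0, and lowering turns it into c q(0) φ(-1). Since q 0 and φ (-1) are
    -- nonzero, c vanishes.
    rw [← hc, lieAct_eq (fun h ↦ (hφ.hasDerivAt 0 trivial _ h).const_smul c)
      (fun h ↦ (hφ.hasDerivAt 0 trivial _ h).const_smul c)] at hkill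
    have hc0 : c • (q 0 • φ (0 - 1)) = 0 := by
      rw [← ladderDeriv_loweringElt κ p q, smul_add, smul_comm c Complex.I]
      exact hkill
    have : c = 0 := by simpa [hq, hφ0] using hc0
    rw [this, zero_smul] at hc
    have hv : v = 0 := by
      rw [← show π (s' v) = v from LinearMap.congr_fun hπs' v,
        show s' v = 0 from Subtype.ext hc.symm, map_zero]
    exact hψ₃0 0 le_rfl (congrArg Subtype.val hv)

end

section

variable {V : Type*} [NormedAddCommGroup V] [NormedSpace ℂ V]

/-! ### Differential operators on the upper half plane -/

theorem isOpen_im_pos : IsOpen {z : ℂ | 0 < z.im} := isOpen_lt continuous_const Complex.continuous_im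

theorem IsSmooth.contDiffAt {F : ℍ → V} (hF : IsSmooth F) (τ : ℍ) :
    ContDiffAt ℝ ∞ (F ∘ UpperHalfPlane.ofComplex) (τ : ℂ) :=
  ContDiffOn.contDiffAt hF (isOpen_im_pos.mem_nhds τ.im_pos)

theorem IsSmooth.differentiableAt {F : ℍ → V} (hF : IsSmooth F) (τ : ℍ) :
    DifferentiableAt ℝ (F ∘ UpperHalfPlane.ofComplex) (τ : ℂ) :=
  (hF.contDiffAt τ).differentiableAt (by simp)

theorem IsSmooth.congr_of_forall {F : ℍ → V} {g : ℂ → V} (hg : ContDiffOn ℝ ∞ g {z : ℂ | 0 < z.im})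
    (h : ∀ τ : ℍ, F τ = g τ) : IsSmooth F :=
  hg.congr fun z hz ↦ by
    rw [Function.comp_apply, h, UpperHalfPlane.ofComplex_apply_of_im_pos hz]

theorem isSmooth_im : IsSmooth (fun τ : ℍ ↦ ((τ.im : ℝ) : ℂ)) :=
  IsSmooth.congr_of_forall (g := fun z : ℂ ↦ ((z.im : ℝ) : ℂ))
    (Complex.ofRealCLM.contDiff.comp Complex.imCLM.contDiff).contDiffOn fun _ ↦ rfl

theorem isSmooth_const (c : V) : IsSmooth (fun _ : ℍ ↦ c) := contDiffOn_const

theorem IsSmooth.add {F G : ℍ → V} (hF : IsSmooth F) (hG : IsSmooth G) :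
    IsSmooth (fun τ ↦ F τ + G τ) := ContDiffOn.add hF hG

theorem IsSmooth.sub {F G : ℍ → V} (hF : IsSmooth F) (hG : IsSmooth G) :
    IsSmooth (fun τ ↦ F τ - G τ) := ContDiffOn.sub hF hG

theorem IsSmooth.smul {c : ℍ → ℂ} {F : ℍ → V} (hc : IsSmooth c) (hF : IsSmooth F) :
    IsSmooth (fun τ ↦ c τ • F τ) := ContDiffOn.smul hc hF

theorem IsSmooth.const_smul {F : ℍ → V} (c : ℂ) (hF : IsSmooth F) :
    IsSmooth (fun τ ↦ c • F τ) := (isSmooth_const c).smul hF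

theorem isSmooth_im_sq : IsSmooth (fun τ : ℍ ↦ ((τ.im : ℝ) : ℂ) ^ 2) := ContDiffOn.pow isSmooth_im 2

theorem isSmooth_im_inv : IsSmooth (fun τ : ℍ ↦ ((τ.im : ℝ) : ℂ)⁻¹) :=
  ContDiffOn.inv isSmooth_im fun z hz ↦ by
    simpa using (UpperHalfPlane.im_ne_zero _)

theorem IsSmooth.dirDeriv {F : ℍ → V} (hF : IsSmooth F) (w : ℂ) : IsSmooth (dirDeriv w F) := by
  refine IsSmooth.congr_of_forall
    (g := fun z ↦ fderiv ℝ (F ∘ UpperHalfPlane.ofComplex) z w) ?_ fun _ ↦ rfl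
  exact (ContDiffOn.fderiv_of_isOpen hF isOpen_im_pos (by simp)).clm_apply contDiffOn_const

theorem IsSmooth.dTau {F : ℍ → V} (hF : IsSmooth F) : IsSmooth (dTau F) :=
  ((hF.dirDeriv 1).sub ((hF.dirDeriv Complex.I).const_smul _)).const_smul _

theorem IsSmooth.dTauBar {F : ℍ → V} (hF : IsSmooth F) : IsSmooth (dTauBar F) :=
  ((hF.dirDeriv 1).add ((hF.dirDeriv Complex.I).const_smul _)).const_smul _

theorem IsSmooth.raising {F : ℍ → V} (hF : IsSmooth F) (m : ℤ) : IsSmooth (raising m F) :=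
  (hF.dTau.const_smul _).add (((isSmooth_im_inv.const_smul _)).smul hF)

theorem IsSmooth.lowering {F : ℍ → V} (hF : IsSmooth F) : IsSmooth (lowering F) :=
  (isSmooth_im_sq.const_smul _).smul hF.dTauBar

theorem dirDeriv_add {F G : ℍ → V} (hF : IsSmooth F) (hG : IsSmooth G) (w : ℂ) (τ : ℍ) :
    dirDeriv w (fun τ ↦ F τ + G τ) τ = dirDeriv w F τ + dirDeriv w G τ :=
  congrArg (· w) (fderiv_add (hF.differentiableAt τ) (hG.differentiableAt τ))

theorem dirDeriv_sub {F G : ℍ → V} (hF : IsSmooth F) (hG : IsSmooth G) (w : ℂ) (τ : ℍ) :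
    dirDeriv w (fun τ ↦ F τ - G τ) τ = dirDeriv w F τ - dirDeriv w G τ :=
  congrArg (· w) (fderiv_sub (hF.differentiableAt τ) (hG.differentiableAt τ))

theorem dirDeriv_smul {c : ℍ → ℂ} {F : ℍ → V} (hc : IsSmooth c) (hF : IsSmooth F) (w : ℂ) (τ : ℍ) :
    dirDeriv w (fun τ ↦ c τ • F τ) τ = c τ • dirDeriv w F τ + dirDeriv w c τ • F τ := by
  have h := congrArg (· w) (fderiv_smul (hc.differentiableAt τ) (hF.differentiableAt τ))
  simpa [dirDeriv] using! h

theorem dirDeriv_const_smul {F : ℍ → V} (c : ℂ) (hF : IsSmooth F) (w : ℂ) (τ : ℍ) :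
    dirDeriv w (fun τ ↦ c • F τ) τ = c • dirDeriv w F τ :=
  congrArg (· w) (fderiv_const_smul (hF.differentiableAt τ) c)

/-- Symmetry of the second derivative, transported through `UpperHalfPlane.ofComplex`, which inverts
the coercion on a neighbourhood of τ. -/
theorem dirDeriv_comm {F : ℍ → V} (hF : IsSmooth F) (w w' : ℂ) (τ : ℍ) :
    dirDeriv w (dirDeriv w' F) τ = dirDeriv w' (dirDeriv w F) τ := by
  set g := F ∘ UpperHalfPlane.ofComplex
  have hd : DifferentiableAt ℝ (fderiv ℝ g) τ :=
    ((hF.contDiffAt τ).fderiv_right (m := ∞) (by simp)).differentiableAt (by simp)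
  have key : ∀ u u' : ℂ, dirDeriv u (dirDeriv u' F) τ = fderiv ℝ (fderiv ℝ g) τ u u' := by
    intro u u'
    have hev : dirDeriv u' F ∘ UpperHalfPlane.ofComplex =ᶠ[nhds (τ : ℂ)]
        fun z ↦ fderiv ℝ g z u' := by
      filter_upwards [isOpen_im_pos.mem_nhds τ.im_pos] with z hz
      rw [Function.comp_apply, UpperHalfPlane.ofComplex_apply_of_im_pos hz]
      rfl
    change fderiv ℝ (dirDeriv u' F ∘ UpperHalfPlane.ofComplex) τ u = _
    rw [hev.fderiv_eq, fderiv_clm_apply hd (differentiableAt_const _)]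
    simp
  rw [key, key]
  exact ((hF.contDiffAt τ).isSymmSndFDerivAt
    (by simpa using WithTop.coe_le_coe.mpr (le_top (a := (2 : ℕ∞))))) w w'

theorem hasFDerivAt_im (τ : ℍ) : HasFDerivAt
    ((fun τ : ℍ ↦ ((τ.im : ℝ) : ℂ)) ∘ UpperHalfPlane.ofComplex)
    (Complex.ofRealCLM.comp Complex.imCLM) (τ : ℂ) := by
  refine (Complex.ofRealCLM.comp Complex.imCLM).hasFDerivAt.congr_of_eventuallyEq ?_
  filter_upwards [isOpen_im_pos.mem_nhds τ.im_pos] with z hz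
  rw [Function.comp_apply, UpperHalfPlane.ofComplex_apply_of_im_pos hz]
  rfl

theorem dirDeriv_im (w : ℂ) (τ : ℍ) :
    dirDeriv w (fun τ : ℍ ↦ ((τ.im : ℝ) : ℂ)) τ = (w.im : ℂ) := by
  rw [dirDeriv, (hasFDerivAt_im τ).fderiv]
  rfl

theorem dirDeriv_im_sq (w : ℂ) (τ : ℍ) :
    dirDeriv w (fun τ : ℍ ↦ ((τ.im : ℝ) : ℂ) ^ 2) τ = 2 * (τ.im : ℂ) * (w.im : ℂ) := by
  have h := dirDeriv_smul isSmooth_im isSmooth_im w τ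
  simp only [dirDeriv_im, smul_eq_mul] at h
  simp only [pow_two]
  rw [h]
  ring

/-- Differentiate the identity v · v⁻¹ = 1. -/
theorem dirDeriv_im_inv (w : ℂ) (τ : ℍ) :
    dirDeriv w (fun τ : ℍ ↦ ((τ.im : ℝ) : ℂ)⁻¹) τ = -(w.im : ℂ) * ((τ.im : ℂ)⁻¹) ^ 2 := by
  have hne : ∀ τ : ℍ, (τ.im : ℂ) ≠ 0 := fun τ ↦ by simpa using τ.im_ne_zero
  have h := dirDeriv_smul isSmooth_im isSmooth_im_inv w τ
  have e : (fun τ : ℍ ↦ ((τ.im : ℝ) : ℂ) • ((τ.im : ℝ) : ℂ)⁻¹) = fun _ ↦ 1 :=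
    funext fun τ ↦ mul_inv_cancel₀ (hne τ)
  rw [e, dirDeriv_im] at h
  have h0 : dirDeriv w (fun _ : ℍ ↦ (1 : ℂ)) τ = 0 := by
    change fderiv ℝ (fun _ : ℂ ↦ (1 : ℂ)) τ w = 0
    simp
  rw [h0, smul_eq_mul, smul_eq_mul] at h
  have := hne τ
  field_simp
  field_simp at h
  linear_combination -h

/-- The commutation relation of the raising and the lowering operator. -/
theorem lowering_raising {F : ℍ → V} (hF : IsSmooth F) (m : ℤ) :
    lowering (raising m F) = raising (m - 4) (lowering F) - ((m : ℂ) / 2) • F := by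
  funext τ
  have h1 := hF.dirDeriv 1
  have hI := hF.dirDeriv Complex.I
  have hR : ∀ w, dirDeriv w (raising m F) τ = (2 * Complex.I) • ((1 / 2 : ℂ) •
      (dirDeriv w (dirDeriv 1 F) τ - Complex.I • dirDeriv w (dirDeriv Complex.I F) τ))
      + (((m : ℂ) / 2 * (τ.im : ℂ)⁻¹) • dirDeriv w F τ
        + ((m : ℂ) / 2 * (-(w.im : ℂ) * ((τ.im : ℂ)⁻¹) ^ 2)) • F τ) := by
    intro w
    have e := dirDeriv_add (hF.dTau.const_smul (2 * Complex.I))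
      ((isSmooth_im_inv.const_smul ((m : ℂ) / 2)).smul hF) w τ
    rw [dirDeriv_const_smul _ hF.dTau, dirDeriv_smul (isSmooth_im_inv.const_smul ((m : ℂ) / 2)) hF,
      dirDeriv_const_smul _ isSmooth_im_inv, dirDeriv_im_inv] at e
    have e' := dirDeriv_const_smul (1 / 2) (h1.sub (hI.const_smul Complex.I)) w τ
    rw [dirDeriv_sub h1 (hI.const_smul Complex.I), dirDeriv_const_smul _ hI] at e'
    rw [show dirDeriv w (dTau F) τ = _ from e'] at e
    exact e
  have hL : ∀ w, dirDeriv w (lowering F) τ = (-2 * Complex.I * (τ.im : ℂ) ^ 2) • ((1 / 2 : ℂ) •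
      (dirDeriv w (dirDeriv 1 F) τ + Complex.I • dirDeriv w (dirDeriv Complex.I F) τ))
      + (-2 * Complex.I * (2 * (τ.im : ℂ) * (w.im : ℂ))) • dTauBar F τ := by
    intro w
    have e := dirDeriv_smul (isSmooth_im_sq.const_smul (-2 * Complex.I)) hF.dTauBar w τ
    rw [dirDeriv_const_smul _ isSmooth_im_sq, dirDeriv_im_sq] at e
    have e' := dirDeriv_const_smul (1 / 2) (h1.add (hI.const_smul Complex.I)) w τ
    rw [dirDeriv_add h1 (hI.const_smul Complex.I), dirDeriv_const_smul _ hI] at e'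
    rw [show dirDeriv w (dTauBar F) τ = _ from e'] at e
    exact e
  have hv : (τ.im : ℂ) ≠ 0 := by simpa using τ.im_ne_zero
  -- The second-order terms agree because mixed derivatives commute. The weight shift by 2 in the
  -- raising operator absorbs the derivative of v², and the derivative of v⁻¹ leaves the multiple of
  -- F.
  rw [lowering, dTauBar, hR, hR, Pi.sub_apply, Pi.smul_apply, raising, dTau, hL, hL,
    dirDeriv_comm hF Complex.I 1, lowering, dTauBar]
  simp only [Complex.one_im, Complex.I_im, Complex.ofReal_one, Complex.ofReal_zero]
  have hII := Complex.I_sq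
  match_scalars <;> field_simp <;> ring_nf <;>
    simp only [hII] <;> ring

theorem lowering_const_smul {F : ℍ → V} (hF : IsSmooth F) (c : ℂ) :
    lowering (c • F) = c • lowering F := by
  funext τ
  have h := fun w ↦ dirDeriv_const_smul c hF w τ
  simp only [lowering, dTauBar, Pi.smul_apply]
  rw [show dirDeriv 1 (c • F) τ = _ from h 1, show dirDeriv Complex.I (c • F) τ = _ from h _]
  module

theorem raising_const_smul {F : ℍ → V} (hF : IsSmooth F) (c : ℂ) (m : ℤ) :
    raising m (c • F) = c • raising m F := by
  funext τ
  have h := fun w ↦ dirDeriv_const_smul c hF w τ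
  simp only [raising, dTau, Pi.smul_apply]
  rw [show dirDeriv 1 (c • F) τ = _ from h 1, show dirDeriv Complex.I (c • F) τ = _ from h _]
  module

end

section

variable {V : Type*} [NormedAddCommGroup V] [NormedSpace ℂ V]

/-! ### Right derivatives of functions pulled back from the upper half plane -/

theorem sl_apply_one_one (X : sl (Fin 2) ℝ) : X.1 1 1 = -X.1 0 0 := by
  have : Matrix.trace X.1 = 0 := X.2
  rw [Matrix.trace_fin_two] at this
  linarith

/-- With X having rows (a, b) and (c, -a), the curve exp(tX) i has velocity b + c + 2ai at t = 0.
The Möbius map of h has derivative (ci + d)⁻² at i, with c, d the lower row of h. -/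
theorem hasDerivAt_smul_I (h : Mp) (X : sl (Fin 2) ℝ) :
    HasDerivAt (fun t : ℝ ↦ (((h.mat * expSL X t) • UpperHalfPlane.I : ℍ) : ℂ))
      (((X.1 1 0 + X.1 0 1 : ℝ) + 2 * (X.1 0 0 : ℝ) * Complex.I) /
        den h.mat UpperHalfPlane.I ^ 2) 0 := by
  have e := hasDerivAt_expSL X
  have h1 := (((e 0 0).const_mul (h.mat 0 0)).add ((e 1 0).const_mul (h.mat 0 1))).ofReal_comp
  have h2 := (((e 0 1).const_mul (h.mat 0 0)).add ((e 1 1).const_mul (h.mat 0 1))).ofReal_comp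
  have hz : den h.mat UpperHalfPlane.I ≠ 0 := den_ne_zero _ _
  have hd := ((h1.mul_const Complex.I).add h2).div (hasDerivAt_den h X) (by
    rw [expSL_zero, mul_one]
    exact hz)
  have hdet : (h.mat 0 0 : ℂ) * h.mat 1 1 - h.mat 0 1 * h.mat 1 0 = 1 := by
    have := h.mat.det_coe
    rw [Matrix.det_fin_two] at this
    exact_mod_cast this
  refine (hd.congr_of_eventuallyEq (.of_forall fun t ↦ ?_)).congr_deriv ?_
  · rw [UpperHalfPlane.coe_specialLinearGroup_apply]
    simp [den, Matrix.SpecialLinearGroup.coe_mul, Matrix.mul_apply, Fin.sum_univ_two]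
  · simp only [expSL_zero, mul_one, sl_apply_one_one, Pi.add_apply]
    congr 1
    simp [den]
    linear_combination ((X.1 1 0 : ℂ) + X.1 0 1 + 2 * X.1 0 0 * Complex.I) * hdet -
      (X.1 1 0 : ℂ) * (h.mat 0 0 * h.mat 1 1 - h.mat 0 1 * h.mat 1 0) * Complex.I_sq

/-- For t near 0 the root is a fixed number times exp of half a principal logarithm
(`root_eventually`), so its integral powers are differentiated as exponentials. -/
theorem hasDerivAt_root_zpow (m : ℤ) (h : Mp) (X : sl (Fin 2) ℝ) :
    HasDerivAt (fun t : ℝ ↦ (h * Mp.lift (expSL X t)).root UpperHalfPlane.I ^ (-m))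
      (h.root UpperHalfPlane.I ^ (-m) * (-(m / 2) *
        ((((h.mat 1 0 * X.1 0 0 + h.mat 1 1 * X.1 1 0 : ℝ) : ℂ) * Complex.I
        + ((h.mat 1 0 * X.1 0 1 + h.mat 1 1 * X.1 1 1 : ℝ) : ℂ)) /
          den h.mat UpperHalfPlane.I))) 0 := by
  have hz0n : den h.mat UpperHalfPlane.I ≠ 0 := den_ne_zero _ _
  have hz := (hasDerivAt_den h X).div_const (den h.mat UpperHalfPlane.I)
  have hL := hz.clog_real (by
    rw [expSL_zero, mul_one, div_self hz0n]; exact Complex.one_mem_slitPlane)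
  rw [expSL_zero, mul_one, div_self hz0n, div_one] at hL
  have hE := ((hL.const_mul (-(m / 2 : ℂ))).cexp).const_mul (h.root UpperHalfPlane.I ^ (-m))
  refine (hE.congr_of_eventuallyEq ?_).congr_deriv ?_
  · filter_upwards [root_eventually h X] with t ht
    rw [ht, mul_zpow, ← Complex.exp_int_mul]
    congr 2
    push_cast
    ring
  · rw [expSL_zero, mul_one, div_self hz0n, Complex.log_one, mul_zero, Complex.exp_zero, one_mul]

theorem pullback_apply (m : ℤ) (F : ℍ → V) (h : Mp) :
    pullback m F h = (h.root UpperHalfPlane.I ^ (-m)) • F (h.mat • UpperHalfPlane.I) := rfl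

theorem root_zpow_neg_add_four (m : ℤ) (h : Mp) :
    h.root UpperHalfPlane.I ^ (-(m + 4)) =
      h.root UpperHalfPlane.I ^ (-m) * (den h.mat UpperHalfPlane.I ^ 2)⁻¹ := by
  rw [← h.sq, neg_add, zpow_add₀ (h.root_ne_zero _), zpow_neg _ 4, ← pow_mul]
  norm_cast

theorem root_zpow_neg_sub_four (m : ℤ) (h : Mp) :
    h.root UpperHalfPlane.I ^ (-(m - 4)) =
      h.root UpperHalfPlane.I ^ (-m) * den h.mat UpperHalfPlane.I ^ 2 := by
  rw [← h.sq, show -(m - 4) = -m + 4 by ring, zpow_add₀ (h.root_ne_zero _), ← pow_mul]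
  norm_cast

theorem im_smul_I_eq (h : Mp) : (((h.mat • UpperHalfPlane.I : ℍ).im : ℝ) : ℂ) =
    (den h.mat UpperHalfPlane.I * starRingEnd ℂ (den h.mat UpperHalfPlane.I))⁻¹ := by
  rw [im_smul_I, Complex.mul_conj, Complex.normSq_eq_norm_sq, ← h.sq, norm_pow]
  push_cast
  ring

/-- The complex-linear part of the differential feeds the raising operator, the antilinear part the
lowering operator. -/
theorem fderiv_eq_dirDeriv (F : ℍ → V) (τ : ℍ) (w : ℂ) :
    fderiv ℝ (F ∘ UpperHalfPlane.ofComplex) (τ : ℂ) w =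
      w • dTau F τ + starRingEnd ℂ w • dTauBar F τ := by
  have e : w = w.re • (1 : ℂ) + w.im • Complex.I := by simp
  have hw : fderiv ℝ (F ∘ UpperHalfPlane.ofComplex) (τ : ℂ) w =
      (w.re : ℂ) • dirDeriv 1 F τ + (w.im : ℂ) • dirDeriv Complex.I F τ := by
    conv_lhs => rw [e]
    rw [map_add, map_smul, map_smul, Complex.coe_smul, Complex.coe_smul]
    rfl
  rw [hw, dTau, dTauBar, Complex.re_eq_add_conj, Complex.im_eq_sub_conj]
  have hI : Complex.I ≠ 0 := Complex.I_ne_zero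
  match_scalars <;> field_simp
  · simp only [Complex.I_sq]
    ring

/-- The dictionary between the Lie algebra and operators on ℍ, by the product rule. The velocity of
the base point is 4i `upCoeff` over z², with conjugate -4i `downCoeff` over the square of the
conjugate of z; here z is the automorphy factor at i. Differentiating the root factor supplies the
rotation term and the k/v term of R. -/
theorem hasDerivAt_pullback {F : ℍ → V} (hF : IsSmooth F) (m : ℤ) (X : sl (Fin 2) ℝ) (h : Mp) :
    HasDerivAt (fun t : ℝ ↦ pullback m F (h * Mp.lift (expSL X t)))
      ((rotCoeff X * (m : ℂ)) • pullback m F h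
        + (2 * upCoeff X) • pullback (m + 4) (raising m F) h
        + (2 * downCoeff X) • pullback (m - 4) (lowering F) h) 0 := by
  set z := den h.mat UpperHalfPlane.I with hz
  set τ := h.mat • UpperHalfPlane.I with hτ
  have hzn : z ≠ 0 := den_ne_zero _ _
  have hcn : starRingEnd ℂ z ≠ 0 := by simpa using hzn
  have hg : HasFDerivAt (F ∘ UpperHalfPlane.ofComplex) (fderiv ℝ (F ∘ UpperHalfPlane.ofComplex) τ)
      (((h.mat * expSL X 0) • UpperHalfPlane.I : ℍ) : ℂ) := by
    rw [expSL_zero, mul_one]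
    exact (hF.differentiableAt τ).hasFDerivAt
  have hcomp := hg.comp_hasDerivAt (0 : ℝ) (hasDerivAt_smul_I h X)
  have hprod := (hasDerivAt_root_zpow m h X).smul hcomp
  refine (hprod.congr_of_eventuallyEq (.of_forall fun t ↦ ?_)).congr_deriv ?_
  · simp [pullback_apply, Mp.lift, UpperHalfPlane.ofComplex_apply]
  · have h0 : (h * Mp.lift (expSL X 0)).root UpperHalfPlane.I = h.root UpperHalfPlane.I := by
      simp [expSL_zero, Mp.lift, den_one]
    rw [h0, fderiv_eq_dirDeriv, Function.comp_apply, Function.comp_apply, expSL_zero, mul_one,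
      UpperHalfPlane.ofComplex_apply, pullback_apply, pullback_apply, pullback_apply,
      root_zpow_neg_add_four, root_zpow_neg_sub_four, raising, lowering, ← hz, ← hτ, hτ,
      im_smul_I_eq, ← hz, ← hτ, sl_apply_one_one]
    have hre : (h.mat 1 1 : ℂ) = (z + starRingEnd ℂ z) / 2 := by
      rw [← Complex.re_eq_add_conj]
      simp [hz, den]
    have him : (h.mat 1 0 : ℂ) = (z - starRingEnd ℂ z) / (2 * Complex.I) := by
      rw [← Complex.im_eq_sub_conj]
      simp [hz, den]
    have hI : Complex.I ≠ 0 := Complex.I_ne_zero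
    have hII := Complex.I_sq
    rw [rotCoeff, upCoeff, downCoeff]
    push_cast
    rw [hre, him]
    simp only [map_div₀, map_add, map_mul, Complex.conj_ofReal, Complex.conj_I, map_pow, map_ofNat]
    set w := starRingEnd ℂ z
    match_scalars <;> field_simp <;> ring_nf <;> simp only [hII] <;> ring

theorem pullback_zero (m : ℤ) : pullback m (0 : ℍ → V) = 0 := by
  funext h
  simp [pullback_apply]

theorem pullback_const_smul (m : ℤ) (c : ℂ) (F : ℍ → V) : pullback m (c • F) = c • pullback m F := by
  funext h
  exact smul_comm (h.root UpperHalfPlane.I ^ (-m)) c (F (h.mat • UpperHalfPlane.I))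

theorem pullback_ne_zero (m : ℤ) {F : ℍ → V} (hF : F ≠ 0) : pullback m F ≠ 0 := by
  obtain ⟨τ, hτ⟩ := Function.ne_iff.mp hF
  intro h0
  have := congrFun h0 (Mp.lift τ.toSL2R)
  rw [pullback_apply] at this
  rw [show (Mp.lift τ.toSL2R).mat • UpperHalfPlane.I = τ from UpperHalfPlane.toSL2R_smul_I τ] at this
  exact hτ ((smul_eq_zero.mp this).resolve_left (zpow_ne_zero _ (Mp.root_ne_zero _ _)))

theorem translate_pullback (m : ℤ) (F : ℍ → V) {x : Mp} (hx : x ∈ Mp.maxCompact) :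
    translate x (pullback m F) = (x.root UpperHalfPlane.I ^ (-m)) • pullback m F := by
  funext h
  rw [translate, pullback_apply, Mp.root_mul, Mp.mat_mul, SemigroupAction.mul_smul, k_smul_I hx,
    mul_zpow, mul_comm, ← smul_smul, Pi.smul_apply, pullback_apply]

theorem isKEigen_pullback (m : ℤ) (F : ℍ → V) : IsKEigen m (pullback m F) := fun θ h ↦ by
  rw [← Mp.root_k_I_zpow]
  exact congrFun (translate_pullback m F (Mp.k_mem_maxCompact θ)) h

theorem isSmoothMp_pullback {F : ℍ → V} (hF : IsSmooth F) (m : ℤ) : IsSmoothMp (pullback m F) := by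
  -- In these coordinates the root at i is v^(-1/4) exp(-iθ/2); its power -m gives the two
  -- exponentials.
  have key : ∀ p ∈ {p : ℂ × ℝ | 0 < p.1.im},
      pullback m F (Mp.lift (UpperHalfPlane.ofComplex p.1).toSL2R * Mp.k p.2) =
      (Complex.exp (Complex.I * ((m : ℂ) / 2) * p.2) *
        Complex.exp ((m / 4 : ℂ) * (Real.log p.1.im : ℝ))) •
        (F ∘ UpperHalfPlane.ofComplex) p.1 := by
    rintro ⟨z, θ⟩ hz
    have hz : 0 < z.im := hz
    have e := isKEigen_pullback m F θ (Mp.lift (UpperHalfPlane.ofComplex z).toSL2R)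
    rw [e, mul_smul, pullback_apply]
    congr 1
    rw [show (Mp.lift (UpperHalfPlane.ofComplex z).toSL2R).mat • UpperHalfPlane.I
      = UpperHalfPlane.ofComplex z from UpperHalfPlane.toSL2R_smul_I _]
    refine congrArg (· • F (UpperHalfPlane.ofComplex z)) ?_
    have hd : den (UpperHalfPlane.ofComplex z).toSL2R UpperHalfPlane.I =
        ((1 / Real.sqrt z.im : ℝ) : ℂ) := by
      simp [den, UpperHalfPlane.ofComplex_apply_of_im_pos hz, UpperHalfPlane.toSL2R_apply]
    have hs : 0 < Real.sqrt z.im := Real.sqrt_pos.mpr hz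
    have hs' : ((1 / Real.sqrt z.im : ℝ) : ℂ) ≠ 0 := by
      exact_mod_cast (by positivity : (1 / Real.sqrt z.im : ℝ) ≠ 0)
    simp only [Mp.lift]
    rw [hd, Complex.cpow_def_of_ne_zero hs', ← Complex.ofReal_log (by positivity), one_div,
      Real.log_inv, Real.log_sqrt hz.le, ← Complex.exp_int_mul]
    congr 1
    push_cast
    ring
  refine ContDiffOn.congr ?_ key
  refine ContDiffOn.smul (ContDiffOn.mul ?_ ?_) (hF.comp contDiffOn_fst fun p hp ↦ hp)
  · exact (ContDiff.cexp (contDiff_const.mul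
      (Complex.ofRealCLM.contDiff.comp contDiff_snd))).contDiffOn
  · refine ContDiffOn.cexp (contDiffOn_const.mul (Complex.ofRealCLM.contDiff.comp_contDiffOn ?_))
    exact ContDiffOn.log (Complex.imCLM.contDiff.comp contDiff_fst).contDiffOn
      fun p hp ↦ (show 0 < p.1.im from hp).ne'

/-! ### Equivariance -/

section Equivariance

variable {Γ : Subgroup Mp} {ρ : Representation ℂ Γ V}

theorem lieAct_equivariant [FiniteDimensional ℂ V] {φ : Mp → V} (hφ : ∀ (γ : Γ) (h : Mp), φ (γ * h) = ρ γ (φ h))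
    (Z : sl (Fin 2) ℂ) (γ : Γ) (h : Mp) : lieAct Z φ (γ * h) = ρ γ (lieAct Z φ h) := by
  let e : V ≃ₗ[ℂ] V := LinearEquiv.ofLinearMap (ρ γ) (ρ γ⁻¹)
    (by rw [← Module.End.mul_eq_comp, ← map_mul, mul_inv_cancel, map_one]; rfl)
    (by rw [← Module.End.mul_eq_comp, ← map_mul, inv_mul_cancel, map_one]; rfl)
  -- A continuous linear equivalence commutes with `fderiv` even where the function is not
  -- differentiable, so no smoothness of φ is needed.
  let E : V ≃L[ℝ] V := e.toContinuousLinearEquiv.restrictScalars ℝ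
  have key : ∀ X, rightDeriv X φ (γ * h) = ρ γ (rightDeriv X φ h) := by
    intro X
    have : (fun t : ℝ ↦ φ (γ * h * Mp.lift (expSL X t)))
        = E ∘ fun t : ℝ ↦ φ (h * Mp.lift (expSL X t)) := by
      funext t
      rw [mul_assoc, hφ]
      rfl
    rw [rightDeriv, this, ← fderiv_apply_one_eq_deriv, E.comp_fderiv]
    rfl
  rw [lieAct, key, key, lieAct, map_add, map_smul]

theorem pullback_equivariant {κ : ℤ} {f : ℍ → V} (hf : IsModular Γ ρ κ f) (γ : Γ) (h : Mp) :
    pullback κ f (γ * h) = ρ γ (pullback κ f h) := by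
  have h1 : ∀ τ, slash κ f γ τ = ρ γ (f τ) := fun τ ↦ by
    rw [← hf γ τ, ← Module.End.mul_apply, ← map_mul, mul_inv_cancel, map_one]
    rfl
  rw [pullback_apply, pullback_apply, map_smul, ← h1, slash, Mp.root_mul, Mp.mat_mul, mul_smul,
    mul_zpow, mul_comm, ← smul_smul]

/-- Left equivariance is preserved by both right actions, so the equivariant functions form a stable
space containing the generator. -/
theorem varpi_equivariant [FiniteDimensional ℂ V] {κ : ℤ} {f : ℍ → V} (hf : IsModular Γ ρ κ f) {φ : Mp → V}
    (hφ : φ ∈ (varpi κ f).space) (γ : Γ) (h : Mp) : φ (γ * h) = ρ γ (φ h) := by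
  let E : Submodule ℂ (Mp → V) :=
    { carrier := {φ | ∀ (γ : Γ) (h : Mp), φ (γ * h) = ρ γ (φ h)}
      add_mem' := fun ha hb γ h ↦ by rw [Pi.add_apply, ha γ h, hb γ h, ← map_add]; rfl
      zero_mem' := fun γ h ↦ (map_zero _).symm
      smul_mem' := fun c a ha γ h ↦ by rw [Pi.smul_apply, ha γ h, ← map_smul]; rfl }
  have hE : (varpi κ f).space ≤ E := sInf_le ⟨fun γ h ↦ pullback_equivariant hf γ h,
    fun Z φ hφ γ h ↦ lieAct_equivariant hφ Z γ h, fun x _ φ hφ γ h ↦ by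
      rw [translate, mul_assoc, hφ]; rfl⟩
  exact hE hφ γ h

end Equivariance

end

section

variable {V : Type*} [NormedAddCommGroup V] [NormedSpace ℂ V]

/-! ### Ladders of functions in the principal series -/

theorem phi_ne_zero (ν : ℂ) (m : ℤ) : phi ν m ≠ 0 := by
  intro h
  have := congrFun h (Mp.k 0)
  rw [phi_k] at this
  exact Complex.exp_ne_zero _ this

theorem isLadder_phi (κ : ℤ) (ν : ℂ) : IsLadder κ (fun j ↦ ν + 1 + ((κ + 4 * j : ℤ) : ℂ) / 2)
    (fun j ↦ ν + 1 - ((κ + 4 * j : ℤ) : ℂ) / 2) Set.univ (fun j ↦ phi ν (κ + 4 * j)) where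
  hasDerivAt j _ X h := by
    refine (hasDerivAt_phi ν (κ + 4 * j) X h).congr_deriv ?_
    simp only [ladderDeriv, rotCoeff, upCoeff, downCoeff, Pi.add_apply, Pi.smul_apply, smul_eq_mul]
    rw [show κ + 4 * (j + 1) = κ + 4 * j + 4 by ring, show κ + 4 * (j - 1) = κ + 4 * j - 4 by ring]
    push_cast
    ring
  translate_eq j _ x hx := phi_translate ν _ hx

theorem varpiPlus_space (κ : ℤ) : (varpiPlus (κ - 2)).space =
    Submodule.span ℂ ((fun j ↦ phi (((κ - 2 : ℤ) : ℂ) / 2) (κ + 4 * j)) '' Set.Ici 0) := by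
  change Submodule.span ℂ _ = _
  congr 1
  ext φ
  constructor
  · rintro ⟨_, ⟨r, rfl⟩, rfl⟩
    exact ⟨r, Set.mem_Ici.mpr (by lia), by simp⟩
  · rintro ⟨j, hj, rfl⟩
    lift j to ℕ using hj
    exact ⟨_, ⟨j, by ring⟩, rfl⟩

theorem varpiMinus_space (κ : ℤ) : (varpiMinus (2 - κ)).space =
    Submodule.span ℂ ((fun j ↦ phi (((2 - κ : ℤ) : ℂ) / 2) (κ + 4 * j)) '' Set.Iio 0) := by
  change Submodule.span ℂ _ = _
  congr 1
  ext φ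
  constructor
  · rintro ⟨_, ⟨r, rfl⟩, rfl⟩
    refine ⟨-1 - r, Set.mem_Iio.mpr (by lia), ?_⟩
    change phi _ _ = phi _ _
    congr 1
    ring
  · rintro ⟨j, hj, rfl⟩
    rw [Set.mem_Iio] at hj
    exact ⟨_, ⟨(-1 - j).toNat, by rw [Int.toNat_of_nonneg (by lia)]; ring⟩, rfl⟩

/-! ### Ladders of functions on the upper half plane -/

theorem isLadder_pullback {κ : ℤ} {p q : ℤ → ℂ} {S : Set ℤ} {F : ℤ → ℍ → V}
    (hF : ∀ j ∈ S, IsSmooth (F j))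
    (hR : ∀ j ∈ S, (2 : ℂ) • raising (κ + 4 * j) (F j) = p j • F (j + 1))
    (hL : ∀ j ∈ S, (2 : ℂ) • lowering (F j) = q j • F (j - 1)) :
    IsLadder κ p q S (fun j ↦ pullback (κ + 4 * j) (F j)) where
  hasDerivAt j hj X h := by
    refine (hasDerivAt_pullback (hF j hj) (κ + 4 * j) X h).congr_deriv ?_
    have e1 := congrArg (pullback (κ + 4 * j + 4)) (hR j hj)
    have e2 := congrArg (pullback (κ + 4 * j - 4)) (hL j hj)
    rw [pullback_const_smul, pullback_const_smul] at e1 e2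
    have e1 := congrFun e1 h
    have e2 := congrFun e2 h
    simp only [Pi.smul_apply] at e1 e2
    simp only [ladderDeriv, Pi.add_apply, Pi.smul_apply]
    rw [show κ + 4 * (j + 1) = κ + 4 * j + 4 by ring, show κ + 4 * (j - 1) = κ + 4 * j - 4 by ring,
      mul_comm 2 (upCoeff X), mul_comm 2 (downCoeff X), mul_comm (p j), mul_comm (q j),
      mul_smul (upCoeff X) 2, mul_smul (downCoeff X) 2, mul_smul (upCoeff X) (p j),
      mul_smul (downCoeff X) (q j), e1, e2]
  translate_eq j _ x hx := translate_pullback _ _ hx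

theorem lowering_zero : lowering (0 : ℍ → V) = 0 := by
  simpa using lowering_const_smul (isSmooth_const (0 : V)) (0 : ℂ)

theorem raising_zero (m : ℤ) : raising m (0 : ℍ → V) = 0 := by
  simpa using raising_const_smul (isSmooth_const (0 : V)) (0 : ℂ) m

/-- Iterated raising of `f`, normalised like the functions `φ_j`. -/
def raisedForm (κ : ℤ) (f : ℍ → V) : ℕ → ℍ → V
  | 0 => f
  | n + 1 => (2 / (κ + 2 * n) : ℂ) • raising (κ + 4 * n) (raisedForm κ f n)

/-- Iterated lowering of `f`, normalised like the functions `φ_j`. -/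
def loweredForm (κ : ℤ) (f : ℍ → V) : ℕ → ℍ → V
  | 0 => (2 : ℂ) • lowering f
  | n + 1 => (2 / (2 * n + 4 - κ) : ℂ) • lowering (loweredForm κ f n)

theorem IsSmooth.raisedForm {f : ℍ → V} (hf : IsSmooth f) (κ : ℤ) (n : ℕ) :
    IsSmooth (raisedForm κ f n) := by
  induction n with
  | zero => exact hf
  | succ n ih => exact (ih.raising _).const_smul _

theorem IsSmooth.loweredForm {f : ℍ → V} (hf : IsSmooth f) (κ : ℤ) (n : ℕ) :
    IsSmooth (loweredForm κ f n) := by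
  induction n with
  | zero => exact hf.lowering.const_smul _
  | succ n ih => exact ih.lowering.const_smul _

/-- Half-integrality of the weight enters here and in the next lemma: it makes the normalisations of
the iterated forms legitimate. -/
theorem add_two_mul_ne_zero {κ : ℤ} (hκ : Odd κ) (n : ℕ) : (κ + 2 * n : ℂ) ≠ 0 := by
  obtain ⟨r, rfl⟩ := hκ
  exact_mod_cast (by lia : 2 * r + 1 + 2 * (n : ℤ) ≠ 0)

theorem two_mul_add_four_sub_ne_zero {κ : ℤ} (hκ : Odd κ) (n : ℕ) :
    (2 * n + 4 - κ : ℂ) ≠ 0 := by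
  obtain ⟨r, rfl⟩ := hκ
  exact_mod_cast (by lia : 2 * (n : ℤ) + 4 - (2 * r + 1) ≠ 0)

/-- The factor κ + 2n is ν + 1 + m/2 for ν = k - 1 and m = κ + 4n, as for φ in the principal series.
-/
theorem raising_raisedForm {κ : ℤ} (hκ : Odd κ) (f : ℍ → V) (n : ℕ) :
    (2 : ℂ) • raising (κ + 4 * n) (raisedForm κ f n) = (κ + 2 * n : ℂ) • raisedForm κ f (n + 1) := by
  have := add_two_mul_ne_zero hκ n
  rw [raisedForm, smul_smul, mul_div_cancel₀ _ this]

/-- The factor is ν + 1 - m/2 for ν = 1 - k and m = κ - 4(n + 1). -/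
theorem lowering_loweredForm {κ : ℤ} (hκ : Odd κ) (f : ℍ → V) (n : ℕ) :
    (2 : ℂ) • lowering (loweredForm κ f n) = (2 * n + 4 - κ : ℂ) • loweredForm κ f (n + 1) := by
  have := two_mul_add_four_sub_ne_zero hκ n
  rw [loweredForm, smul_smul, mul_div_cancel₀ _ this]

/-- Induction by the commutation relation. Harmonicity gives L R f = -k f at the start, and the step
rests on (n+1)(κ+2n) + (κ+4n+4) = (n+2)(κ+2n+2). -/
theorem lowering_raisedForm {κ : ℤ} (hκ : Odd κ) {f : ℍ → V} (hf : IsSmooth f)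
    (hh : raising (κ - 4) (lowering f) = 0) (n : ℕ) :
    lowering (raisedForm κ f (n + 1)) = (-(n + 1) : ℂ) • raisedForm κ f n := by
  induction n with
  | zero =>
    have h0 := add_two_mul_ne_zero hκ 0
    simp only [raisedForm]
    rw [lowering_const_smul (hf.raising _), lowering_raising hf]
    simp only [Nat.cast_zero, mul_zero, add_zero, hh, zero_sub] at h0 ⊢
    match_scalars
    field_simp
    simp
  | succ n ih =>
    have h0 := add_two_mul_ne_zero hκ (n + 1)
    have hs := hf.raisedForm κ (n + 1)
    rw [raisedForm, lowering_const_smul (hs.raising _), lowering_raising hs, ih,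
      raising_const_smul (hf.raisedForm κ n),
      show κ + 4 * ((n + 1 : ℕ) : ℤ) - 4 = κ + 4 * n by push_cast; ring,
      show raising (κ + 4 * n) (raisedForm κ f n) = (2 : ℂ)⁻¹ • ((κ + 2 * n : ℂ) •
        raisedForm κ f (n + 1)) by rw [← raising_raisedForm hκ, smul_smul]; norm_num]
    match_scalars
    push_cast at h0 ⊢
    field_simp
    ring

/-- The mirror image of `lowering_raisedForm`; the induction starts from the vanishing of R on L f.
-/
theorem raising_loweredForm {κ : ℤ} (hκ : Odd κ) {f : ℍ → V} (hf : IsSmooth f)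
    (hh : raising (κ - 4) (lowering f) = 0) (n : ℕ) :
    raising (κ - 4 * (n + 2)) (loweredForm κ f (n + 1)) = (-(n + 1) : ℂ) • loweredForm κ f n := by
  have comm : ∀ n : ℕ, raising (κ - 4 * (n + 2)) (lowering (loweredForm κ f n)) =
      lowering (raising (κ - 4 * (n + 1)) (loweredForm κ f n))
        + (((κ - 4 * (n + 1) : ℤ) : ℂ) / 2) • loweredForm κ f n := fun n ↦ by
    rw [lowering_raising (hf.loweredForm κ n), sub_add_cancel]
    congr 1
    ring
  induction n with
  | zero =>
    have h0 := two_mul_add_four_sub_ne_zero hκ 0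
    have hz : raising (κ - 4 * ((0 : ℕ) + 1)) (loweredForm κ f 0) = 0 := by
      rw [loweredForm, raising_const_smul hf.lowering]
      simp [hh]
    rw [show loweredForm κ f (0 + 1) = (2 / (2 * (0 : ℕ) + 4 - κ) : ℂ) •
      lowering (loweredForm κ f 0) from rfl,
      raising_const_smul (hf.loweredForm κ 0).lowering, comm, hz]
    rw [lowering_zero]
    match_scalars
    push_cast at h0 ⊢
    field_simp
    ring
  | succ n ih =>
    have h0 := two_mul_add_four_sub_ne_zero hκ (n + 1)
    rw [loweredForm, raising_const_smul (hf.loweredForm κ (n + 1)).lowering, comm,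
      show κ - 4 * (((n + 1 : ℕ) : ℤ) + 1) = κ - 4 * (n + 2) by push_cast; ring, ih,
      lowering_const_smul (hf.loweredForm κ n),
      show lowering (loweredForm κ f n) = (2 : ℂ)⁻¹ • ((2 * n + 4 - κ : ℂ) •
        loweredForm κ f (n + 1)) by rw [← lowering_loweredForm hκ, smul_smul]; norm_num]
    match_scalars
    push_cast at h0 ⊢
    field_simp
    ring

/-- Lowering returns a nonzero multiple of the preceding form, so a zero would propagate down to f.
-/
theorem raisedForm_ne_zero {κ : ℤ} (hκ : Odd κ) {f : ℍ → V} (hf : IsSmooth f)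
    (hh : raising (κ - 4) (lowering f) = 0) (hf0 : f ≠ 0) (n : ℕ) : raisedForm κ f n ≠ 0 := by
  induction n with
  | zero => exact hf0
  | succ n ih =>
    intro h
    have e := lowering_raisedForm hκ hf hh n
    rw [h, lowering_zero] at e
    exact ih ((smul_eq_zero.mp e.symm).resolve_left
      (neg_ne_zero.mpr (Nat.cast_add_one_ne_zero n)))

theorem loweredForm_ne_zero {κ : ℤ} (hκ : Odd κ) {f : ℍ → V} (hf : IsSmooth f)
    (hh : raising (κ - 4) (lowering f) = 0) (hf0 : lowering f ≠ 0) (n : ℕ) :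
    loweredForm κ f n ≠ 0 := by
  induction n with
  | zero => exact smul_ne_zero two_ne_zero hf0
  | succ n ih =>
    intro h
    have e := raising_loweredForm hκ hf hh n
    rw [h, raising_zero] at e
    exact ih ((smul_eq_zero.mp e.symm).resolve_left
      (neg_ne_zero.mpr (Nat.cast_add_one_ne_zero n)))

/-- The forms obtained from `f` by raising and lowering, indexed by the integers. -/
def formLadder (κ : ℤ) (f : ℍ → V) : ℤ → ℍ → V
  | Int.ofNat n => raisedForm κ f n
  | Int.negSucc n => loweredForm κ f n

/-- The coefficients of raising in `formLadder`. -/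
def upSeq (κ : ℤ) (j : ℤ) : ℂ := if j < 0 then 2 + 2 * j else κ + 2 * j

/-- The coefficients of lowering in `formLadder`. -/
def downSeq (κ : ℤ) (j : ℤ) : ℂ := if j < 0 then 2 - κ - 2 * j else if j = 0 then 1 else -2 * j

/-- The coefficients agree with those of `isLadder_phi_minus` for j < 0 and of `isLadder_phi_plus`
for j ≥ 0, except for lowering at j = 0: there the value is 1, because F_{-1} is defined as 2 L f.
-/
theorem isLadder_formLadder {κ : ℤ} (hκ : Odd κ) {f : ℍ → V} (hf : IsSmooth f)
    (hh : raising (κ - 4) (lowering f) = 0) : IsLadder κ (upSeq κ) (downSeq κ) Set.univ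
      (fun j ↦ pullback (κ + 4 * j) (formLadder κ f j)) := by
  refine isLadder_pullback (fun j _ ↦ ?_) (fun j _ ↦ ?_) (fun j _ ↦ ?_)
  · cases j with
    | ofNat n => exact hf.raisedForm κ n
    | negSucc n => exact hf.loweredForm κ n
  · rcases j with n | n
    · change (2 : ℂ) • raising (κ + 4 * (n : ℤ)) (raisedForm κ f n) = _ • raisedForm κ f (n + 1)
      rw [raising_raisedForm hκ, upSeq, if_neg (show ¬ Int.ofNat n < 0 from (Int.natCast_nonneg n).not_gt)]
      simp
    · rcases n with _ | n
      -- Raising from index -1 is harmonicity itself, matching `upSeq κ (-1) = 0`.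
      · have : raising (κ - 4) (loweredForm κ f 0) = 0 := by
          rw [loweredForm, raising_const_smul hf.lowering, hh, smul_zero]
        simpa [upSeq, formLadder, sub_eq_add_neg] using this
      · have e := raising_loweredForm hκ hf hh n
        change (2 : ℂ) • raising _ (loweredForm κ f (n + 1)) = _ • loweredForm κ f n
        rw [show κ + 4 * Int.negSucc (n + 1) = κ - 4 * (n + 2) by
          rw [Int.negSucc_eq]; push_cast; ring, e, upSeq, if_pos (Int.negSucc_lt_zero _),
          smul_smul, Int.negSucc_eq]
        congr 1
        push_cast
        ring
  · rcases j with n | n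
    · rcases n with _ | n
      · change (2 : ℂ) • lowering f = downSeq κ 0 • (2 : ℂ) • lowering f
        simp [downSeq]
      · have e := lowering_raisedForm hκ hf hh n
        have hn : Int.ofNat (n + 1) - 1 = n := by simp
        rw [hn]
        change (2 : ℂ) • lowering (raisedForm κ f (n + 1)) = _ • raisedForm κ f n
        rw [e, smul_smul, downSeq, if_neg (by simp; lia), if_neg (by simp; lia)]
        congr 1
        simp
        ring
    · have e := lowering_loweredForm hκ f n
      change (2 : ℂ) • lowering (loweredForm κ f n) = _ • loweredForm κ f (n + 1)
      rw [e, downSeq, if_pos (Int.negSucc_lt_zero _), Int.negSucc_eq]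
      congr 1
      push_cast
      ring

/-! ### Holomorphy as vanishing of the lowering operator, and membership in the space of automorphic
functions. -/

/-- The right-hand side is the Cauchy–Riemann equation in the form used by
`differentiableAt_complex_iff_differentiableAt_real`. -/
theorem lowering_eq_zero_iff (f : ℍ → V) :
    lowering f = 0 ↔ ∀ τ, dirDeriv Complex.I f τ = Complex.I • dirDeriv 1 f τ := by
  rw [funext_iff]
  refine forall_congr' fun τ ↦ ?_
  have h : (-2 * Complex.I * ((τ.im : ℝ) : ℂ) ^ 2) ≠ 0 := by
    simpa using τ.im_ne_zero
  rw [lowering, Pi.zero_apply, smul_eq_zero_iff_right h, dTauBar,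
    smul_eq_zero_iff_right (by norm_num)]
  have e : dirDeriv 1 f τ + Complex.I • dirDeriv Complex.I f τ =
      Complex.I • (dirDeriv Complex.I f τ - Complex.I • dirDeriv 1 f τ) := by
    rw [smul_sub, smul_smul, Complex.I_mul_I]
    module
  rw [e, smul_eq_zero_iff_right Complex.I_ne_zero, sub_eq_zero]

theorem differentiableOn_iff_lowering_eq_zero {f : ℍ → V} (hf : IsSmooth f) :
    DifferentiableOn ℂ (f ∘ UpperHalfPlane.ofComplex) {z : ℂ | 0 < z.im} ↔ lowering f = 0 := by
  rw [lowering_eq_zero_iff]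
  constructor
  · intro h τ
    exact (differentiableAt_complex_iff_differentiableAt_real.mp
      (h.differentiableAt (isOpen_im_pos.mem_nhds τ.im_pos))).2
  · intro h z hz
    exact (differentiableAt_complex_iff_differentiableAt_real.mpr
      ⟨hf.differentiableAt ⟨z, hz⟩, h ⟨z, hz⟩⟩).differentiableWithinAt

theorem isSmooth_of_differentiableOn [CompleteSpace V] {f : ℍ → V}
    (hf : DifferentiableOn ℂ (f ∘ UpperHalfPlane.ofComplex) {z : ℂ | 0 < z.im}) : IsSmooth f :=
  (hf.contDiffOn isOpen_im_pos).restrict_scalars ℝ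

theorem pullback_mem_span (m : ℤ) {F : ℍ → V} (hF : IsSmooth F) :
    pullback m F ∈ Submodule.span ℂ {φ : Mp → V | IsSmoothMp φ ∧ ∃ m : ℤ, IsKEigen m φ} :=
  Submodule.subset_span ⟨isSmoothMp_pullback hF m, m, isKEigen_pullback m F⟩

theorem isSmooth_formLadder {f : ℍ → V} (hf : IsSmooth f) (κ j : ℤ) :
    IsSmooth (formLadder κ f j) := by
  cases j with
  | ofNat n => exact hf.raisedForm κ n
  | negSucc n => exact hf.loweredForm κ n

theorem isHarishChandraIn_varpi [FiniteDimensional ℂ V] {Γ : Subgroup Mp}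
    {ρ : Representation ℂ Γ V} {κ : ℤ} {f : ℍ → V} (hf : IsSmooth f) (hm : IsModular Γ ρ κ f)
    {p q : ℤ → ℂ} {S : Set ℤ}
    (hW : (varpi κ f).space =
      Submodule.span ℂ ((fun j ↦ pullback (κ + 4 * j) (formLadder κ f j)) '' S))
    (hl : IsLadder κ p q S (fun j ↦ pullback (κ + 4 * j) (formLadder κ f j)))
    (hne : ∀ j ∈ S, formLadder κ f j ≠ 0) : IsHarishChandraIn Γ ρ (varpi κ f) := by
  refine ⟨le_inf ?_ fun φ hφ ↦ varpi_equivariant hm hφ,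
    hl.isAdmissible hW fun j hj ↦ pullback_ne_zero _ (hne j hj)⟩
  rw [hW, Submodule.span_le]
  rintro _ ⟨j, -, rfl⟩
  exact pullback_mem_span _ (isSmooth_formLadder hf κ j)

theorem varpi_eq_generated (κ : ℤ) (f : ℍ → V) :
    varpi κ f = generated ((fun j ↦ pullback (κ + 4 * j) (formLadder κ f j)) 0) := by
  simp [varpi, formLadder, raisedForm]

/-- The ladder of `φ_j` in the range that spans `ϖ⁺(k - 1)`. -/
theorem isLadder_phi_plus (κ : ℤ) : IsLadder κ (fun j ↦ (κ + 2 * j : ℂ)) (fun j ↦ (-2 * j : ℂ))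
    Set.univ (fun j ↦ phi (((κ - 2 : ℤ) : ℂ) / 2) (κ + 4 * j)) := by
  refine (isLadder_phi κ _).congr fun j _ ↦ Or.inl ⟨trivial, rfl, ?_, ?_⟩ <;>
  · congr 1
    push_cast
    ring

/-- The ladder of `φ_j` in the range that spans `ϖ⁻(1 - k)`. -/
theorem isLadder_phi_minus (κ : ℤ) : IsLadder κ (fun j ↦ (2 + 2 * j : ℂ))
    (fun j ↦ (2 - κ - 2 * j : ℂ))
    Set.univ (fun j ↦ phi (((2 - κ : ℤ) : ℂ) / 2) (κ + 4 * j)) := by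
  refine (isLadder_phi κ _).congr fun j _ ↦ Or.inl ⟨trivial, rfl, ?_, ?_⟩ <;>
  · congr 1
    push_cast
    ring

end

end

end Metaplectic

/-! ### The modules of weakly holomorphic and of harmonic forms. -/

theorem mainTheorem1 {V : Type*} [NormedAddCommGroup V] [NormedSpace ℂ V] [FiniteDimensional ℂ V]
    (Γ : Subgroup Metaplectic.Mp) (hΓ : Γ ≤ Metaplectic.Mp.integral)
    (hfin : (Γ.subgroupOf Metaplectic.Mp.integral).FiniteIndex)
    (ρ : Representation ℂ Γ V) (κ : ℤ) (hκ : Odd κ) (f : ℍ → V) :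
    (Metaplectic.IsWeaklyHolomorphic Γ ρ κ f → f ≠ 0 →
      Metaplectic.IsHarishChandraIn Γ ρ (Metaplectic.varpi κ f) ∧
      Metaplectic.GKIsomorphic (Metaplectic.varpi κ f) (Metaplectic.varpiPlus (κ - 2))) ∧
    (Metaplectic.IsHarmonicWeakMaassForm Γ ρ κ f → ¬ Metaplectic.IsWeaklyHolomorphic Γ ρ κ f →
      Metaplectic.IsHarishChandraIn Γ ρ (Metaplectic.varpi κ f) ∧
      Metaplectic.IsNonsplitExtension (Metaplectic.varpiMinus (2 - κ)) (Metaplectic.varpi κ f)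
        (Metaplectic.varpiPlus (κ - 2))) := by
  open Metaplectic in
  have hp0 : ∀ j : ℤ, (κ + 2 * j : ℂ) ≠ 0 := fun j ↦ by
    obtain ⟨r, rfl⟩ := hκ
    exact_mod_cast (by lia : 2 * r + 1 + 2 * j ≠ 0)
  have hq0 : ∀ j : ℤ, (2 - κ - 2 * j : ℂ) ≠ 0 := fun j ↦ by
    obtain ⟨r, rfl⟩ := hκ
    exact_mod_cast (by lia : 2 - (2 * r + 1) - 2 * j ≠ 0)
  constructor
  · intro hf hf0
    have : CompleteSpace V := FiniteDimensional.complete ℂ V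
    have hs := isSmooth_of_differentiableOn hf.holo
    have hlow := (differentiableOn_iff_lowering_eq_zero hs).mp hf.holo
    have hh : raising (κ - 4) (lowering f) = 0 := by rw [hlow, raising_zero]
    have hm1 : formLadder κ f (0 - 1) = 0 := by
      change (2 : ℂ) • lowering f = 0
      rw [hlow, smul_zero]
    have hne : ∀ j ∈ Set.Ici (0 : ℤ), formLadder κ f j ≠ 0 := fun j hj ↦ by
      lift j to ℕ using hj
      exact raisedForm_ne_zero hκ hs hh hf0 j
    -- On j ≥ 0 the coefficients differ from those of ϖ⁺(k - 1) only for lowering at 0, and there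
    -- the target form is zero by `hm1`.
    have hl : IsLadder κ (fun j ↦ (κ + 2 * j : ℂ)) (fun j ↦ (-2 * j : ℂ)) (Set.Ici 0)
        (fun j ↦ pullback (κ + 4 * j) (formLadder κ f j)) :=
      (isLadder_formLadder hκ hs hh).congr fun j hj ↦ Or.inl ⟨trivial, rfl, by
        rw [upSeq, if_neg (not_lt.mpr hj)], by
        rw [downSeq, if_neg (not_lt.mpr hj)]
        split_ifs with h
        · rw [h, hm1, pullback_zero, smul_zero, smul_zero]
        · rfl⟩
    have hcl : LadderClosed (fun j ↦ (κ + 2 * j : ℂ)) (fun j ↦ (-2 * j : ℂ)) (Set.Ici 0) :=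
      fun j hj ↦ by
        rw [Set.mem_Ici] at hj
        refine ⟨Or.inr (Set.mem_Ici.mpr (by lia)), ?_⟩
        rcases eq_or_ne j 0 with rfl | h
        · simp
        · exact Or.inr (Set.mem_Ici.mpr (by lia))
    have hW := hl.generated_space hcl (Set.mem_Ici.mpr le_rfl)
      (fun j _ h ↦ ⟨Set.mem_Ici.mpr (by lia), hp0 _⟩)
      (fun j hj h ↦ absurd h (not_lt.mpr hj))
    rw [← varpi_eq_generated] at hW
    exact ⟨isHarishChandraIn_varpi hs hf.modular hW hl hne,
      hl.gkIsomorphic hW (varpiPlus_space κ) ((isLadder_phi_plus κ).mono (Set.subset_univ _)) hcl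
        (fun j hj ↦ pullback_ne_zero _ (hne j hj)) (fun j _ ↦ phi_ne_zero _ _)⟩
  · intro hf hnw
    have hs := hf.smooth
    -- Modularity and growth are common to both notions of form, so f can only fail to be
    -- holomorphic.
    have hlow : lowering f ≠ 0 := fun h ↦
      hnw ⟨(differentiableOn_iff_lowering_eq_zero hs).mpr h, hf.modular, hf.growth⟩
    have hf0 : f ≠ 0 := by
      rintro rfl
      exact hlow lowering_zero
    have hh : raising (κ - 4) (lowering f) = 0 := by
      funext τ
      exact neg_eq_zero.mp (congrFun hf.harmonic τ)
    have hne : ∀ j, formLadder κ f j ≠ 0 := fun j ↦ by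
      rcases j with n | n
      · exact raisedForm_ne_zero hκ hs hh hf0 n
      · exact loweredForm_ne_zero hκ hs hh hlow n
    have hl := isLadder_formLadder hκ hs hh
    have hup : ∀ j, 0 ≤ j → upSeq κ j = κ + 2 * j := fun j hj ↦ if_neg (not_lt.mpr hj)
    have hdown : ∀ j < 0, downSeq κ j = 2 - κ - 2 * j := fun j hj ↦ if_pos hj
    have hq1 : downSeq κ 0 = 1 := by simp [downSeq]
    -- Every step away from index 0 has a nonzero coefficient: κ + 2j upwards, 1 from 0 to -1, and 2
    -- - κ - 2j further down.
    have hW := hl.generated_space (fun j _ ↦ ⟨Or.inr trivial, Or.inr trivial⟩) trivial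
      (fun j _ h ↦ ⟨trivial, by rw [hup _ (by lia)]; exact hp0 _⟩)
      (fun j _ h ↦ ⟨trivial, by
        rcases eq_or_ne j (-1) with rfl | h'
        · rw [neg_add_cancel, hq1]
          exact one_ne_zero
        · rw [hdown _ (by lia)]
          exact hq0 _⟩)
    rw [← varpi_eq_generated] at hW
    exact ⟨isHarishChandraIn_varpi hs hf.modular hW hl fun j _ ↦ hne j,
      IsLadder.isNonsplitExtension hW (varpiMinus_space κ) (varpiPlus_space κ) hl
        ((isLadder_phi_minus κ).mono (Set.subset_univ _))
        ((isLadder_phi_plus κ).mono (Set.subset_univ _))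
        (fun j ↦ pullback_ne_zero _ (hne j)) (fun j _ ↦ phi_ne_zero _ _)
        (fun j _ ↦ phi_ne_zero _ _) (fun j hj ↦ if_pos hj) hdown hup
        (fun j hj ↦ by rw [downSeq, if_neg hj.not_gt, if_neg hj.ne']) (by simp [upSeq])
        (by rw [hq1]; exact one_ne_zero) (by simp)⟩
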